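/- All graphs are finite and simple. The clique-width of a graph $G$ is the minimum number of labels needed to construct $G$ by the following four operations: creating a single vertex with label $i$; taking the disjoint union of two labelled graphs; joining every vertex with label $i$ to every vertex with label $j$ ($i\neq j$); renaming label $i$ to $j$. A class of graphs has bounded clique-width if some constant bounds the clique-width of all its members, and unbounded clique-width otherwise. For a set $\mathcal{H}$ of graphs, a graph is $\mathcal{H}$-free if it has no induced subgraph isomorphic to a member of $\mathcal{H}$. A graph is self-complementary if it is isomorphic to its complement, and split if its vertex set can be partitioned into a (possibly empty) clique and a (possibly empty) independent set. $C_4$ is the cycle on four vertices, $2P_2$ is the disjoint union of two edges, and the bull is the graph obtained from a triangle by attaching one pendant vertex to each of two of its vertices. For $h\ge 1$, the wall of height $h$ is the graph whose vertices are the points $(x,y)\in\mathbb{Z}^2$ with $0\le x\le 2h+1$ and $0\le y\le h$, except the point $(0,0)$ and the point $(x_h,h)$, where $x_h=2h+1$ if $h$ is even and $x_h=0$ if $h$ is odd; $(x,y)$ is adjacent to $(x+1,y)$ always and to $(x,y+1)$ if and only if $x+y$ is odd (whenever both points are vertices). Let $W_h$ be the graph obtained from it by subdividing every edge exactly twice.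 **Theorem.** Let $\mathcal{F}$ be the set of all self-complementary graphs on at least five vertices that are not isomorphic to the bull. Then the class of $(\{C_4,2P_2\}\cup\mathcal{F})$-free graphs has unbounded clique-width, and every graph in this class is a split graph. Moreover, for every $h\ge 1$ the graph $W_h$ is bipartite, and for each bipartition $(A,B)$ of $W_h$ the graph $W_h^A$ obtained from $W_h$ by complementing the subgraph induced by $A$ is $(\{C_4,2P_2\}\cup\mathcal{F})$-free; and for every $c$ there is an $h\ge 1$ such that $W_h^A$ has clique-width greater than $c$ for each bipartition $(A,B)$ of $W_h$. -/

import Mathlib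

open scoped SimpleGraph

/-- A finite simple graph, bundled with its vertex type. -/
structure FinGraph where
  V : Type
  graph : SimpleGraph V
  [fin : Finite V]

namespace CliqueWidth

/-! ### Clique-width -/

/-- Expressions over the label set `Fin k`, built from the four operations of clique-width. -/
inductive CWExpr (k : ℕ) : Type
  /-- create a single vertex with label `i` -/
  | vertex (i : Fin k) : CWExpr k
  /-- disjoint union -/
  | union (e₁ e₂ : CWExpr k) : CWExpr k
  /-- join each vertex with label `i` to each vertex with label `j`, where `i ≠ j` -/
  | join (i j : Fin k) (hij : i ≠ j) (e : CWExpr k) : CWExpr k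
  /-- rename label `i` to `j` -/
  | rename (i j : Fin k) (e : CWExpr k) : CWExpr k

namespace CWExpr

variable {k : ℕ}

/-- The vertices of the graph built by an expression. -/
def Verts : CWExpr k → Type
  | vertex _ => Unit
  | union e₁ e₂ => e₁.Verts ⊕ e₂.Verts
  | join _ _ _ e => e.Verts
  | rename _ _ e => e.Verts

/-- The labels of the vertices of the graph built by an expression. -/
def label : (e : CWExpr k) → e.Verts → Fin k
  | vertex i => fun _ => i
  | union e₁ e₂ => Sum.elim e₁.label e₂.label
  | join _ _ _ e => e.label
  | rename i j e => fun v => if e.label v = i then j else e.label v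

/-- The graph built by an expression. -/
def graph : (e : CWExpr k) → SimpleGraph e.Verts
  | vertex _ => (⊥ : SimpleGraph Unit)
  | union e₁ e₂ => e₁.graph ⊕g e₂.graph
  | join i j _ e => e.graph ⊔ SimpleGraph.fromRel (fun u v => e.label u = i ∧ e.label v = j)
  | rename _ _ e => e.graph

end CWExpr

/-- `G` can be constructed with `k` labels. -/
def ConstructibleWith {V : Type*} (G : SimpleGraph V) (k : ℕ) : Prop :=
  ∃ e : CWExpr k, Nonempty (e.graph ≃g G)

/-- The clique-width of a finite graph: the minimum number of labels needed to construct it.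
(The graph without vertices, which no expression constructs, gets the value `0`.) -/
noncomputable def cliqueWidth {V : Type*} (G : SimpleGraph V) : ℕ :=
  sInf {k | ConstructibleWith G k}

/-- A class of graphs has bounded clique-width if some constant bounds the clique-width of all
its members. -/
def BoundedCliqueWidth (𝒢 : Set FinGraph) : Prop :=
  ∃ c : ℕ, ∀ G ∈ 𝒢, cliqueWidth G.graph ≤ c

/-! ### Graph classes -/

/-- The class of `ℋ`-free graphs: no induced subgraph is isomorphic to a member of `ℋ`. -/
def freeClass (ℋ : Set FinGraph) : Set FinGraph :=
  {G | ∀ H ∈ ℋ, ¬ H.graph ⊴ G.graph}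

/-- A graph is self-complementary if it is isomorphic to its complement. -/
def IsSelfComplementary {V : Type*} (G : SimpleGraph V) : Prop :=
  Nonempty (G ≃g Gᶜ)

/-- A graph is split if its vertex set can be partitioned into a (possibly empty) clique and a
(possibly empty) independent set. -/
def IsSplit {V : Type*} (G : SimpleGraph V) : Prop :=
  ∃ C : Set V, G.IsClique C ∧ G.IsIndepSet Cᶜ

/-- The cycle on four vertices. -/
def C4 : FinGraph := ⟨Fin 4, SimpleGraph.cycleGraph 4⟩

/-- The disjoint union of two paths on two vertices. -/
def twoP2 : FinGraph := ⟨Fin 2 ⊕ Fin 2, SimpleGraph.pathGraph 2 ⊕g SimpleGraph.pathGraph 2⟩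

/-- The bull: a triangle with pendant vertices attached to two of its vertices. -/
def bull : SimpleGraph (Fin 5) :=
  SimpleGraph.fromEdgeSet {s(0, 1), s(1, 2), s(0, 2), s(0, 3), s(1, 4)}

/-- All self-complementary graphs on at least five vertices other than the bull. -/
def selfComplementaryNotBull : Set FinGraph :=
  {F | IsSelfComplementary F.graph ∧ 5 ≤ Nat.card F.V ∧ ¬ Nonempty (F.graph ≃g bull)}

/-! ### Complemented 2-subdivided walls -/

/-- The vertices of the wall of height `h`: the points `(x, y)` with `0 ≤ x ≤ 2h + 1` and
`0 ≤ y ≤ h`, except for one end of the bottom row and one end of the top row (these two points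
would have degree one). -/
abbrev WallVertex (h : ℕ) : Type :=
  {p : Fin (2 * h + 2) × Fin (h + 1) //
    ¬ (p.1.val = 0 ∧ p.2.val = 0) ∧
    ¬ (p.1.val = (if Even h then 2 * h + 1 else 0) ∧ p.2.val = h)}

/-- The wall of height `h`, drawn as `h` rows of `h` bricks: consecutive points of a row are
adjacent, and `(x, y)` is adjacent to `(x, y + 1)` when `x + y` is odd. -/
def wall (h : ℕ) : SimpleGraph (WallVertex h) :=
  SimpleGraph.fromRel fun p q =>
    (p.1.2.val = q.1.2.val ∧ p.1.1.val + 1 = q.1.1.val) ∨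
    (p.1.1.val = q.1.1.val ∧ p.1.2.val + 1 = q.1.2.val ∧ Odd (p.1.1.val + p.1.2.val))

/-- The graph obtained from `G` by subdividing each edge exactly twice. The two new vertices on
an edge `uv` are its two orientations: the edge becomes the path `u, (u,v), (v,u), v`. -/
def twoSubdivision {V : Type*} (G : SimpleGraph V) : SimpleGraph (V ⊕ G.Dart) :=
  SimpleGraph.fromRel fun a b =>
    match a, b with
    | Sum.inl v, Sum.inr d => d.fst = v
    | Sum.inr d, Sum.inr d' => d' = d.symm
    | _, _ => False

/-- The graph obtained from `G` by complementing the subgraph induced by `S`. -/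
def complementOn {V : Type*} (G : SimpleGraph V) (S : Set V) : SimpleGraph V where
  Adj u v := u ≠ v ∧ (G.Adj u v ↔ ¬ (u ∈ S ∧ v ∈ S))
  symm := ⟨fun u v ⟨hne, h⟩ => ⟨hne.symm, by rw [G.adj_comm, h, and_comm]⟩⟩
  loopless := ⟨fun _ h => h.1 rfl⟩

instance finite_dart {V : Type*} [Finite V] (G : SimpleGraph V) : Finite G.Dart :=
  Finite.of_injective _ (SimpleGraph.Dart.toProd_injective (G := G))

/-- The vertices of the 2-subdivided wall of height `h`. -/
abbrev SubdividedWallVertex (h : ℕ) : Type := WallVertex h ⊕ (wall h).Dart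

/-- The 2-subdivided wall of height `h`. -/
def subdividedWall (h : ℕ) : SimpleGraph (SubdividedWallVertex h) :=
  twoSubdivision (wall h)

/-- The graph obtained from the 2-subdivided wall of height `h` by complementing the vertex
set `A`. -/
def complementedWall (h : ℕ) (A : Set (SubdividedWallVertex h)) : FinGraph :=
  ⟨SubdividedWallVertex h, complementOn (subdividedWall h) A⟩

end CliqueWidth

open CliqueWidth

namespace CliqueWidth

/-! ### Clique-width: constructibility and balanced cuts of low complexity -/

namespace CWExpr

variable {k : ℕ}

/-! Large clique-width. In a `k`-expression, descend to a subexpression whose vertex set `U` holds a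
balanced share of a prescribed set of vertices, here an `N × N` array of wall cells. Vertices of `U`
with equal labels there have the same neighbours outside `U` (`CWExpr.exists_balanced`). Recording
also membership in `A` undoes the complementation, so in the subdivided wall itself `U` has at most
`2k` neighbourhoods outside. As degrees are at most three, `U` cuts at most `6k` of the disjoint
rows and at most `6k` of the disjoint vertical strips (`card_not_isUncut_le`). An uncut row or strip
has all of its cells on one side of `U`, and every row meets every strip, so `U` contains almost
none or almost all of the cells, against balance (`lt_cliqueWidth_complementedWall`).

Membership in the class. The complemented wall is split, which excludes `C₄` and `2P₂`. A
self-complementary split graph consists, apart from at most one vertex, of a clique `K` and an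
independent set `I` of the same size `l`, with exactly `l² / 2` edges between them
(`IsSelfComplementary.exists_balanced_parts`, `IsSelfComplementary.two_mul_card_eq`). Inside the
complemented wall these are edges of the 2-subdivision, which is so sparse that `l ≤ 2`
(`card_le_two_of_two_mul_card_eq`). On at least five vertices only the bull remains.

All members are split. `C₅` is self-complementary and not the bull, so members have no induced `C₄`,
`2P₂` or `C₅`; by the theorem of Földes and Hammer they are split (`isSplit_of_free`). -/

instance finite_verts (e : CWExpr k) : Finite e.Verts := by
  induction e with
  | vertex i => exact inferInstanceAs (Finite Unit)
  | union e₁ e₂ h₁ h₂ => exact inferInstanceAs (Finite (e₁.Verts ⊕ e₂.Verts))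
  | join i j hij e h => exact h
  | rename i j e h => exact h

/-- Each nonempty set of labels is the set of labels of an edgeless graph with distinct labels. -/
theorem exists_edgeless (s : Finset (Fin k)) (hs : s.Nonempty) :
    ∃ e : CWExpr k, Function.Injective e.label ∧ Set.range e.label = s ∧ e.graph = ⊥ := by
  induction hs using Finset.Nonempty.cons_induction with
  | singleton a =>
    refine ⟨vertex a, fun _ _ _ => rfl, ?_, rfl⟩
    ext x
    constructor
    · rintro ⟨_, rfl⟩
      simp [label]
    · intro hx
      exact ⟨(), by simpa [label, eq_comm] using hx⟩
  | cons a s ha _ ih =>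
    obtain ⟨e, hinj, hrange, hgraph⟩ := ih
    have hmem : ∀ v, e.label v ∈ s := fun v => by
      rw [← Finset.mem_coe, ← hrange]
      exact Set.mem_range_self v
    refine ⟨union (vertex a) e, ?_, ?_, ?_⟩
    · refine Function.Injective.sumElim (fun _ _ _ => rfl) hinj ?_
      intro _ v h
      exact ha ((show a = e.label v from h) ▸ hmem v)
    · show Set.range (Sum.elim _ _) = _
      rw [Set.Sum.elim_range, hrange]
      ext x
      have : x ∈ Set.range (vertex a).label ↔ x = a :=
        ⟨fun ⟨_, h⟩ => h.symm, fun h => ⟨(), h.symm⟩⟩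
      simp [this]
    · change ((⊥ : SimpleGraph Unit) ⊕g e.graph) = ⊥
      rw [hgraph]
      ext (u | u) (v | v) <;> simp

theorem join_adj (i j : Fin k) (hij : i ≠ j) (e : CWExpr k) (u v : e.Verts) :
    (join i j hij e).graph.Adj u v ↔ e.graph.Adj u v ∨
      (u ≠ v ∧ (e.label u = i ∧ e.label v = j ∨ e.label v = i ∧ e.label u = j)) :=
  Iff.rfl

/-- Each graph on the set of all labels is constructible with each vertex labelled by itself. -/
theorem exists_of_pairs (hk : 0 < k) (P : Finset (Fin k × Fin k)) :
    ∃ e : CWExpr k, Function.Bijective e.label ∧ ∀ u v, e.graph.Adj u v ↔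
      u ≠ v ∧ ((e.label u, e.label v) ∈ P ∨ (e.label v, e.label u) ∈ P) := by
  classical
  induction P using Finset.induction_on with
  | empty =>
    have : Nonempty (Fin k) := ⟨⟨0, hk⟩⟩
    obtain ⟨e, hinj, hrange, hgraph⟩ := exists_edgeless (Finset.univ : Finset (Fin k))
      Finset.univ_nonempty
    refine ⟨e, ⟨hinj, Set.range_eq_univ.mp (by simpa using hrange)⟩, ?_⟩
    simp [hgraph]
  | insert p P hp ih =>
    obtain ⟨e, hbij, hadj⟩ := ih
    obtain ⟨i, j⟩ := p
    by_cases hij : i = j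
    · refine ⟨e, hbij, fun u v => ?_⟩
      rw [hadj]
      refine and_congr_right fun huv => ?_
      have := hbij.1.ne huv
      simp only [Finset.mem_insert, Prod.mk.injEq]
      grind
    · refine ⟨join i j hij e, hbij, fun (u v : e.Verts) => ?_⟩
      refine (join_adj i j hij e u v).trans ?_
      change _ ↔ u ≠ v ∧ ((e.label u, e.label v) ∈ insert (i, j) P ∨
        (e.label v, e.label u) ∈ insert (i, j) P)
      rw [hadj]
      simp only [Finset.mem_insert, Prod.mk.injEq]
      tauto

/-- A graph constructed with `k` labels has, for each set `T` of at least `s ≥ 1` vertices, a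
vertex set `U` that contains at least `s` and less than `2 * s` vertices of `T` and is partitioned
into `k` sets of vertices with the same neighbours outside `U`. -/
theorem exists_balanced (e : CWExpr k) {s : ℕ} (hs : 1 ≤ s) (T : Set e.Verts)
    (hT : s ≤ T.ncard) :
    ∃ (U : Set e.Verts) (f : e.Verts → Fin k), s ≤ (U ∩ T).ncard ∧ (U ∩ T).ncard < 2 * s ∧
      ∀ u ∈ U, ∀ v ∈ U, f u = f v → e.label u = e.label v ∧
        ∀ w ∉ U, (e.graph.Adj u w ↔ e.graph.Adj v w) := by
  induction e with
  | vertex i =>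
    refine ⟨Set.univ, fun _ => i, ?_, ?_, ?_⟩
    · rwa [Set.univ_inter]
    · rw [Set.univ_inter]
      have : T.ncard ≤ 1 := Set.ncard_le_one_iff_subsingleton.mpr fun _ _ _ _ => rfl
      omega
    · exact fun u _ v _ _ => ⟨rfl, fun w hw => absurd (Set.mem_univ w) hw⟩
  | join i j hij e ih =>
    obtain ⟨U, f, h₁, h₂, h₃⟩ := ih T hT
    refine ⟨U, f, h₁, h₂, fun (u : e.Verts) hu (v : e.Verts) hv huv => ?_⟩
    -- The equality of current labels is carried through the induction for this case: a later join
    -- cannot distinguish `u` from `v`.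
    obtain ⟨hl, hn⟩ := h₃ u hu v hv huv
    refine ⟨hl, fun (w : e.Verts) hw => ?_⟩
    have huw : u ≠ w := fun h => hw (h ▸ hu)
    have hvw : v ≠ w := fun h => hw (h ▸ hv)
    refine (join_adj i j hij e u w).trans (Iff.trans ?_ (join_adj i j hij e v w).symm)
    rw [hn w hw, hl]
    tauto
  | rename i j e ih =>
    obtain ⟨U, f, h₁, h₂, h₃⟩ := ih T hT
    refine ⟨U, f, h₁, h₂, fun u hu v hv huv => ?_⟩
    obtain ⟨hl, hn⟩ := h₃ u hu v hv huv
    exact ⟨by simp only [label, hl], hn⟩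
  | union e₁ e₂ ih₁ ih₂ =>
    change Set (e₁.Verts ⊕ e₂.Verts) at T
    have hcard : T.ncard = (Sum.inl ⁻¹' T).ncard + (Sum.inr ⁻¹' T).ncard := by
      conv_lhs => rw [← Set.image_preimage_inl_union_image_preimage_inr T]
      rw [Set.ncard_union_eq, Set.ncard_image_of_injective _ Sum.inl_injective,
        Set.ncard_image_of_injective _ Sum.inr_injective]
      exact Set.disjoint_image_inl_image_inr
    by_cases c₁ : s ≤ (Sum.inl ⁻¹' T).ncard
    · obtain ⟨U, f, h₁, h₂, h₃⟩ := ih₁ _ c₁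
      -- `f x` is only a default value outside `U`; `s ≥ 1` provides the point `x`.
      obtain ⟨x, hx⟩ : (U ∩ Sum.inl ⁻¹' T).Nonempty := by
        rw [← Set.ncard_pos]
        omega
      have himage : (Sum.inl '' U ∩ T).ncard = (U ∩ Sum.inl ⁻¹' T).ncard := by
        rw [← Set.image_inter_preimage, Set.ncard_image_of_injective _ Sum.inl_injective]
      refine ⟨Sum.inl '' U, Sum.elim f (fun _ => f x), himage ▸ h₁, himage ▸ h₂, ?_⟩
      rintro _ ⟨u, hu, rfl⟩ _ ⟨v, hv, rfl⟩ huv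
      obtain ⟨hl, hn⟩ := h₃ u hu v hv huv
      refine ⟨hl, ?_⟩
      rintro (w | w) hw
      · have hwU : w ∉ U := fun h => hw ⟨w, h, rfl⟩
        exact hn w hwU
      · exact Iff.rfl
    by_cases c₂ : s ≤ (Sum.inr ⁻¹' T).ncard
    · obtain ⟨U, f, h₁, h₂, h₃⟩ := ih₂ _ c₂
      obtain ⟨x, hx⟩ : (U ∩ Sum.inr ⁻¹' T).Nonempty := by
        rw [← Set.ncard_pos]
        omega
      have himage : (Sum.inr '' U ∩ T).ncard = (U ∩ Sum.inr ⁻¹' T).ncard := by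
        rw [← Set.image_inter_preimage, Set.ncard_image_of_injective _ Sum.inr_injective]
      refine ⟨Sum.inr '' U, Sum.elim (fun _ => f x) f, himage ▸ h₁, himage ▸ h₂, ?_⟩
      rintro _ ⟨u, hu, rfl⟩ _ ⟨v, hv, rfl⟩ huv
      obtain ⟨hl, hn⟩ := h₃ u hu v hv huv
      refine ⟨hl, ?_⟩
      rintro (w | w) hw
      · exact Iff.rfl
      · have hwU : w ∉ U := fun h => hw ⟨w, h, rfl⟩
        exact hn w hwU
    -- The descent stops here: both sides have fewer than `s` vertices of `T`, so the whole has
    -- fewer than `2 * s`.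
    · refine ⟨(Set.univ : Set (e₁.Verts ⊕ e₂.Verts)), (union e₁ e₂).label, ?_, ?_, ?_⟩
      · change s ≤ (Set.univ ∩ T).ncard
        rwa [Set.univ_inter]
      · change (Set.univ ∩ T).ncard < 2 * s
        rw [Set.univ_inter]
        omega
      · exact fun u _ v _ h => ⟨h, fun w hw => absurd (Set.mem_univ w) hw⟩

end CWExpr

/-- One label per vertex suffices. Lower bounds on `cliqueWidth` depend on this, because `sInf ∅ =
0`. -/
theorem exists_constructibleWith {V : Type*} [Finite V] [Nonempty V] (G : SimpleGraph V) :
    ∃ k, ConstructibleWith G k := by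
  classical
  obtain ⟨k, ⟨φ⟩⟩ := Finite.exists_equiv_fin V
  have hk : 0 < k := by
    have := (φ (Classical.arbitrary V)).isLt
    omega
  obtain ⟨e, hbij, hadj⟩ := CWExpr.exists_of_pairs hk
    (Finset.univ.filter fun p => G.Adj (φ.symm p.1) (φ.symm p.2))
  refine ⟨k, e, ⟨⟨(Equiv.ofBijective _ hbij).trans φ.symm, ?_⟩⟩⟩
  intro u v
  rw [hadj]
  simp only [Equiv.trans_apply, Equiv.ofBijective_apply, Finset.mem_filter, Finset.mem_univ,
    true_and]
  constructor
  · exact fun h => ⟨fun huv => h.ne (by rw [huv]), Or.inl h⟩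
  · rintro ⟨_, h | h⟩
    · exact h
    · exact h.symm

theorem lt_cliqueWidth_iff {V : Type*} [Finite V] [Nonempty V] (G : SimpleGraph V) (c : ℕ) :
    c < cliqueWidth G ↔ ∀ k ≤ c, ¬ ConstructibleWith G k := by
  constructor
  · exact fun h k hk hG => absurd (Nat.sInf_le (s := {k | ConstructibleWith G k}) hG)
      (by unfold cliqueWidth at h; omega)
  · intro h
    by_contra hc
    exact h _ (not_lt.mp hc)
      (Nat.sInf_mem (s := {k | ConstructibleWith G k}) (exists_constructibleWith G))

theorem ConstructibleWith.exists_balanced {V : Type*} {G : SimpleGraph V} {k : ℕ}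
    (h : ConstructibleWith G k) {s : ℕ} (hs : 1 ≤ s) (T : Set V) (hT : s ≤ T.ncard) :
    ∃ (U : Set V) (f : V → Fin k), s ≤ (U ∩ T).ncard ∧ (U ∩ T).ncard < 2 * s ∧
      ∀ u ∈ U, ∀ v ∈ U, f u = f v → ∀ w ∉ U, (G.Adj u w ↔ G.Adj v w) := by
  obtain ⟨e, ⟨φ⟩⟩ := h
  have hcard : ∀ S : Set V, (φ ⁻¹' S).ncard = S.ncard := fun S =>
    Set.ncard_preimage_of_injective_subset_range φ.injective (by simp [φ.surjective.range_eq])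
  obtain ⟨U, f, h₁, h₂, h₃⟩ := e.exists_balanced hs (φ ⁻¹' T) (by rwa [hcard])
  have himage : U ∩ φ ⁻¹' T = φ ⁻¹' (φ.symm ⁻¹' U ∩ T) := by
    ext x
    simp
  rw [himage, hcard] at h₁ h₂
  refine ⟨φ.symm ⁻¹' U, f ∘ φ.symm, h₁, h₂, fun u hu v hv huv w hw => ?_⟩
  have := (h₃ _ hu _ hv huv).2 _ hw
  rwa [φ.symm.map_adj_iff, φ.symm.map_adj_iff] at this

/-! ### Subdivided graphs and walls -/

section TwoSubdivision

variable {V : Type*} {G : SimpleGraph V}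

@[simp] theorem twoSubdivision_adj_inl_inl (u v : V) :
    ¬ (twoSubdivision G).Adj (Sum.inl u) (Sum.inl v) := by
  simp [twoSubdivision]

@[simp] theorem twoSubdivision_adj_inl_inr (v : V) (d : G.Dart) :
    (twoSubdivision G).Adj (Sum.inl v) (Sum.inr d) ↔ d.fst = v := by
  simp [twoSubdivision]

@[simp] theorem twoSubdivision_adj_inr_inl (v : V) (d : G.Dart) :
    (twoSubdivision G).Adj (Sum.inr d) (Sum.inl v) ↔ d.fst = v := by
  simp [twoSubdivision]

@[simp] theorem twoSubdivision_adj_inr_inr (d d' : G.Dart) :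
    (twoSubdivision G).Adj (Sum.inr d) (Sum.inr d') ↔ d' = d.symm := by
  have h : d = d'.symm ↔ d' = d.symm := by
    rw [eq_comm, SimpleGraph.Dart.symm_involutive.eq_iff]
  have hne : d' = d.symm → d ≠ d' := fun h h' => d.symm_ne (h ▸ h').symm
  simp only [twoSubdivision, SimpleGraph.fromRel_adj, ne_eq, Sum.inr.injEq, h, or_self]
  tauto

theorem ncard_dart_fst_le [Finite V] (v : V) :
    {d : G.Dart | d.fst = v}.ncard ≤ (G.neighborSet v).ncard := by
  refine Set.ncard_le_ncard_of_injOn (fun d => d.snd) ?_ ?_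
  · rintro d rfl
    exact d.adj
  · intro d hd d' hd' h
    exact SimpleGraph.Dart.ext _ _ (Prod.ext ((hd : d.fst = v).trans (hd' : d'.fst = v).symm) h)

theorem ncard_neighborSet_twoSubdivision_le [Finite V]
    (hG : ∀ v, (G.neighborSet v).ncard ≤ 3) (a : V ⊕ G.Dart) :
    ((twoSubdivision G).neighborSet a).ncard ≤ 3 := by
  rcases a with v | d
  · have : (twoSubdivision G).neighborSet (Sum.inl v) = Sum.inr '' {d : G.Dart | d.fst = v} := by
      ext (u | d) <;> simp
    rw [this, Set.ncard_image_of_injective _ Sum.inr_injective]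
    exact (ncard_dart_fst_le v).trans (hG v)
  · have : (twoSubdivision G).neighborSet (Sum.inr d) ⊆ {Sum.inl d.fst, Sum.inr d.symm} := by
      rintro (u | d') h
      · left
        simpa [eq_comm] using h
      · right
        simpa using h
    exact (Set.ncard_le_ncard this).trans ((Set.ncard_insert_le _ _).trans (by simp))

/-- The subset of the subdivided graph that corresponds to the subgraph induced by `P`. -/
def within (G : SimpleGraph V) (P : Set V) : Set (V ⊕ G.Dart) :=
  {a | Sum.elim (· ∈ P) (fun d => d.fst ∈ P ∧ d.snd ∈ P) a}

theorem disjoint_within {P Q : Set V} (h : Disjoint P Q) :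
    Disjoint (within G P) (within G Q) := by
  rw [Set.disjoint_left] at h ⊢
  rintro (v | d) hP hQ
  · exact h hP hQ
  · exact h hP.1 hQ.1

end TwoSubdivision

/-! ### Cuts -/

section Cut

variable {V : Type*}

/-- No edge within `S` leaves the set `U`. -/
def IsUncut (G : SimpleGraph V) (U S : Set V) : Prop :=
  ∀ a ∈ S, ∀ b ∈ S, G.Adj a b → (a ∈ U ↔ b ∈ U)

theorem exists_cut_edge_of_not_isUncut {G : SimpleGraph V} {U S : Set V}
    (h : ¬ IsUncut G U S) : ∃ a ∈ S, ∃ b ∉ U, a ∈ U ∧ G.Adj a b := by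
  unfold IsUncut at h
  push Not at h
  obtain ⟨a, ha, b, hb, hab, h | h⟩ := h
  · exact ⟨a, ha, b, h.2, h.1, hab⟩
  · exact ⟨b, hb, a, h.1, h.2, hab.symm⟩

/-- The whole path `u, (u,v), (v,u), v` lies in `within G P`, so membership in `U` propagates along
it. -/
theorem IsUncut.mem_iff_of_adj {G : SimpleGraph V} {U : Set (V ⊕ G.Dart)} {P : Set V}
    (h : IsUncut (twoSubdivision G) U (within G P)) {u v : V} (hu : u ∈ P) (hv : v ∈ P)
    (huv : G.Adj u v) : (Sum.inl u ∈ U ↔ Sum.inl v ∈ U) := by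
  let d : G.Dart := ⟨(u, v), huv⟩
  have hd : Sum.inr d ∈ within G P := ⟨hu, hv⟩
  have hd' : Sum.inr d.symm ∈ within G P := ⟨hv, hu⟩
  exact ((h (Sum.inl u) hu (Sum.inr d) hd (by simp [d])).trans
    (h (Sum.inr d) hd (Sum.inr d.symm) hd' (by simp))).trans
    (h (Sum.inr d.symm) hd' (Sum.inl v) hv (by simp [d]))

/-- In a graph of maximum degree three, a set with few kinds of neighbourhoods in its complement
cuts few of any family of disjoint sets. -/
theorem card_not_isUncut_le [Finite V] [Nonempty V] {G : SimpleGraph V}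
    (hG : ∀ v, (G.neighborSet v).ncard ≤ 3) {κ ι : Type*} [Fintype κ] {U : Set V} {g : V → κ}
    (hg : ∀ u ∈ U, ∀ v ∈ U, g u = g v → ∀ w ∉ U, (G.Adj u w ↔ G.Adj v w))
    {R : ι → Set V} (hR : Pairwise fun i j => Disjoint (R i) (R j)) (M : Finset ι)
    (hM : ∀ i ∈ M, ¬ IsUncut G U (R i)) : M.card ≤ 3 * Fintype.card κ := by
  classical
  have hex : ∀ i, ∃ a b, i ∈ M → a ∈ R i ∧ b ∉ U ∧ a ∈ U ∧ G.Adj a b := by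
    intro i
    by_cases hi : i ∈ M
    · obtain ⟨a, ha, b, hb, haU, hab⟩ := exists_cut_edge_of_not_isUncut (hM i hi)
      exact ⟨a, b, fun _ => ⟨ha, hb, haU, hab⟩⟩
    · exact ⟨Classical.arbitrary V, Classical.arbitrary V, fun h => absurd h hi⟩
  choose u w hex using hex
  have huR := fun i hi => (hex i hi).1
  have hw := fun i hi => (hex i hi).2.1
  have huU := fun i hi => (hex i hi).2.2.1
  have hadj := fun i hi => (hex i hi).2.2.2
  have hinj : Set.InjOn u (M : Set ι) := by
    intro i hi j hj hij
    by_contra hne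
    exact Set.disjoint_left.mp (hR hne) (huR i hi) (hij ▸ huR j hj)
  refine (Finset.card_le_mul_card_image (f := fun i => g (u i)) M 3 ?_).trans
    (Nat.mul_le_mul_left 3 (Finset.card_le_univ _))
  -- All chosen `u i` of the same class as `u i₀` are neighbours of the single vertex `w i₀`, so
  -- each class contains at most three of them.
  intro b hb
  obtain ⟨i₀, hi₀, rfl⟩ := Finset.mem_image.mp hb
  rw [← Set.ncard_coe_finset]
  refine (Set.ncard_le_ncard_of_injOn u (t := G.neighborSet (w i₀)) ?_ ?_).trans (hG _)
  · intro i hi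
    obtain ⟨hiM, hi⟩ := Finset.mem_filter.mp hi
    exact ((hg _ (huU i hiM) _ (huU i₀ hi₀) hi _ (hw i₀ hi₀)).mpr (hadj i₀ hi₀)).symm
  · exact hinj.mono fun i hi => (Finset.mem_filter.mp hi).1

/-- A subset of a grid that cuts at most `t < N` rows and at most `t` columns covers at most `t`
columns or all but `t` columns. -/
theorem card_filter_le_or_of_grid {N t : ℕ} (ht : t < N) (P : Fin N → Fin N → Prop)
    [∀ i j, Decidable (P i j)] (rows cols : Finset (Fin N)) (hrows : rows.card ≤ t)
    (hcols : cols.card ≤ t)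
    (hr : ∀ y ∉ rows, ∀ i j, P i y ↔ P j y) (hc : ∀ i ∉ cols, ∀ y z, P i y ↔ P i z) :
    ((Finset.univ : Finset (Fin N × Fin N)).filter fun p => P p.1 p.2).card ≤ t * N ∨
    ((Finset.univ : Finset (Fin N × Fin N)).filter fun p => ¬ P p.1 p.2).card ≤ t * N := by
  classical
  obtain ⟨y₀, hy₀⟩ : ∃ y, y ∉ rows := by
    by_contra! h
    have := Finset.card_le_card (fun y _ => h y : Finset.univ ⊆ rows)
    rw [Finset.card_univ, Fintype.card_fin] at this
    omega
  have hN : 0 < N := by omega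
  -- All uncut columns meet the uncut row `y₀`, hence they all lie on the same side; exceptions are
  -- confined to the `t` cut columns.
  have key : ∀ i ∉ cols, ∀ y, P i y ↔ P ⟨0, hN⟩ y₀ := fun i hi y =>
    (hc i hi y y₀).trans (hr y₀ hy₀ _ _)
  have hcard : (cols ×ˢ (Finset.univ : Finset (Fin N))).card ≤ t * N := by
    rw [Finset.card_product, Finset.card_univ, Fintype.card_fin]
    exact Nat.mul_le_mul_right N hcols
  by_cases hP : P ⟨0, hN⟩ y₀
  · right
    refine (Finset.card_le_card fun p hp => ?_).trans hcard
    by_contra hcol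
    simp only [Finset.mem_product, Finset.mem_univ, and_true] at hcol
    exact (Finset.mem_filter.mp hp).2 ((key _ hcol _).mpr hP)
  · left
    refine (Finset.card_le_card fun p hp => ?_).trans hcard
    by_contra hcol
    simp only [Finset.mem_product, Finset.mem_univ, and_true] at hcol
    exact hP ((key _ hcol _).mp (Finset.mem_filter.mp hp).2)

end Cut

/-! ### Rows and strips of the wall, and the lower bound on clique-width. -/

section Wall

variable {h : ℕ}

theorem wall_adj (p q : WallVertex h) : (wall h).Adj p q ↔ p ≠ q ∧
    (((p.1.2.val = q.1.2.val ∧ p.1.1.val + 1 = q.1.1.val) ∨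
      (p.1.1.val = q.1.1.val ∧ p.1.2.val + 1 = q.1.2.val ∧ Odd (p.1.1.val + p.1.2.val))) ∨
    ((q.1.2.val = p.1.2.val ∧ q.1.1.val + 1 = p.1.1.val) ∨
      (q.1.1.val = p.1.1.val ∧ q.1.2.val + 1 = p.1.2.val ∧ Odd (q.1.1.val + q.1.2.val)))) :=
  Iff.rfl

theorem WallVertex.ext {p q : WallVertex h} (hx : p.1.1.val = q.1.1.val)
    (hy : p.1.2.val = q.1.2.val) : p = q :=
  Subtype.ext (Prod.ext (Fin.ext hx) (Fin.ext hy))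

/-- A neighbour is determined by its direction: right, left or vertical. The parity of `x + y`
decides between up and down. -/
theorem ncard_neighborSet_wall_le (p : WallVertex h) : ((wall h).neighborSet p).ncard ≤ 3 := by
  have : (Set.univ : Set (Fin 3)).ncard = 3 := by simp [Set.ncard_univ]
  rw [← this]
  refine Set.ncard_le_ncard_of_injOn (fun q => if p.1.1.val + 1 = q.1.1.val then 0 else
    if q.1.1.val + 1 = p.1.1.val then 1 else 2) (fun _ _ => Set.mem_univ _) ?_
  intro q hq r hr hqr
  simp only [SimpleGraph.mem_neighborSet, wall_adj, Nat.odd_iff] at hq hr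
  replace hq := hq.2
  replace hr := hr.2
  have h₁ : (p.1.1.val + 1 = q.1.1.val ↔ p.1.1.val + 1 = r.1.1.val) ∧
      (q.1.1.val + 1 = p.1.1.val ↔ r.1.1.val + 1 = p.1.1.val) := by
    by_cases c₁ : p.1.1.val + 1 = q.1.1.val <;> by_cases c₂ : p.1.1.val + 1 = r.1.1.val <;>
      by_cases c₃ : q.1.1.val + 1 = p.1.1.val <;> by_cases c₄ : r.1.1.val + 1 = p.1.1.val <;>
      simp [c₁, c₂, c₃, c₄] at hqr ⊢ <;> omega
  apply WallVertex.ext <;> omega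

theorem ncard_neighborSet_subdividedWall_le (a : SubdividedWallVertex h) :
    ((subdividedWall h).neighborSet a).ncard ≤ 3 :=
  ncard_neighborSet_twoSubdivision_le ncard_neighborSet_wall_le a

theorem exists_isBipartiteWith_subdividedWall (h : ℕ) :
    ∃ A : Set (SubdividedWallVertex h), (subdividedWall h).IsBipartiteWith A Aᶜ := by
  have hwall : ∀ p q : WallVertex h, (wall h).Adj p q →
      (Even (p.1.1.val + p.1.2.val) ↔ ¬ Even (q.1.1.val + q.1.2.val)) := by
    intro p q hpq
    rw [wall_adj] at hpq
    simp only [Nat.even_iff, Nat.odd_iff] at hpq ⊢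
    omega
  -- Wall points are coloured by the parity of `x + y`, and each subdivision vertex oppositely to
  -- the wall point next to it.
  refine ⟨{a | Sum.elim (fun p => Even (p.1.1.val + p.1.2.val))
    (fun d => ¬ Even (d.fst.1.1.val + d.fst.1.2.val)) a}, disjoint_compl_right, ?_⟩
  suffices H : ∀ a b, (subdividedWall h).Adj a b →
      (Sum.elim (fun p : WallVertex h => Even (p.1.1.val + p.1.2.val))
        (fun d : (wall h).Dart => ¬ Even (d.fst.1.1.val + d.fst.1.2.val)) a ↔
      ¬ Sum.elim (fun p : WallVertex h => Even (p.1.1.val + p.1.2.val))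
        (fun d : (wall h).Dart => ¬ Even (d.fst.1.1.val + d.fst.1.2.val)) b) by
    intro a b hab
    have := H a b hab
    simp only [Set.mem_compl_iff, Set.mem_ofPred_eq]
    tauto
  unfold subdividedWall
  rintro (p | d) (q | d') hab
  · simp at hab
  · rw [twoSubdivision_adj_inl_inr] at hab
    simp [hab]
  · rw [twoSubdivision_adj_inr_inl] at hab
    simp [hab]
  · rw [twoSubdivision_adj_inr_inr] at hab
    have := hwall _ _ d.adj
    subst hab
    simp only [Sum.elim_inr]
    exact not_congr this

/-- The right point of the `j`-th pair of consecutive points in the row `y` of a wall. -/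
def wallCell (hh : Odd h) (j y : Fin (h + 1)) : WallVertex h :=
  ⟨(⟨2 * j.val + 1, by omega⟩, y), by
    -- For odd `h` both missing points have `x = 0`, so every point with odd `x` is a vertex.
    rw [if_neg (Nat.not_even_iff_odd.mpr hh)]
    exact ⟨fun hj => by simp at hj, fun hj => by simp at hj⟩⟩

@[simp] theorem wallCell_x (hh : Odd h) (j y : Fin (h + 1)) :
    (wallCell hh j y).1.1.val = 2 * j.val + 1 := rfl

@[simp] theorem wallCell_y (hh : Odd h) (j y : Fin (h + 1)) :
    (wallCell hh j y).1.2.val = y.val := rfl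

/-- The row `y` of a wall. -/
def wallRow (h : ℕ) (y : Fin (h + 1)) : Set (WallVertex h) := {p | p.1.2 = y}

/-- The `j`-th vertical strip of a wall. -/
def wallStrip (h : ℕ) (j : Fin (h + 1)) : Set (WallVertex h) := {p | p.1.1.val / 2 = j.val}

theorem wallCell_mem_wallRow (hh : Odd h) (j y : Fin (h + 1)) :
    wallCell hh j y ∈ wallRow h y := rfl

theorem wallCell_mem_wallStrip (hh : Odd h) (j y : Fin (h + 1)) :
    wallCell hh j y ∈ wallStrip h j := by
  show (2 * j.val + 1) / 2 = j.val
  omega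

theorem IsUncut.wallRow (hh : Odd h) {U : Set (SubdividedWallVertex h)} {y : Fin (h + 1)}
    (hU : IsUncut (subdividedWall h) U (within (wall h) (wallRow h y))) (i j : Fin (h + 1)) :
    Sum.inl (wallCell hh i y) ∈ U ↔ Sum.inl (wallCell hh j y) ∈ U := by
  suffices H : ∀ (n : ℕ) (hn : n < h + 1), (Sum.inl (wallCell hh ⟨n, hn⟩ y) ∈ U ↔
      Sum.inl (wallCell hh 0 y) ∈ U) from (H i.val i.isLt).trans (H j.val j.isLt).symm
  intro n
  induction n with
  | zero => exact fun _ => Iff.rfl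
  | succ n ih =>
    intro hn
    rw [← ih (by omega)]
    let p : WallVertex h := ⟨(⟨2 * n + 2, by omega⟩, y), by
      rw [if_neg (Nat.not_even_iff_odd.mpr hh)]
      exact ⟨fun hj => by simp at hj, fun hj => by simp at hj⟩⟩
    have hp : p ∈ CliqueWidth.wallRow h y := rfl
    refine (hU.mem_iff_of_adj (wallCell_mem_wallRow hh _ y) hp ?_).trans
      (hU.mem_iff_of_adj hp (wallCell_mem_wallRow hh _ y) ?_)
    · refine ⟨fun he => ?_, Or.inr (Or.inl ⟨rfl, ?_⟩)⟩
      · have := congrArg (fun p : WallVertex h => p.1.1.val) he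
        simp [p] at this
        omega
      · simp [p]
        omega
    · refine ⟨fun he => ?_, Or.inr (Or.inl ⟨rfl, ?_⟩)⟩
      · have := congrArg (fun p : WallVertex h => p.1.1.val) he
        simp [p] at this
      · simp [p]

theorem IsUncut.wallStrip (hh : Odd h) {U : Set (SubdividedWallVertex h)} {j : Fin (h + 1)}
    (hU : IsUncut (subdividedWall h) U (within (wall h) (wallStrip h j))) (y z : Fin (h + 1)) :
    Sum.inl (wallCell hh j y) ∈ U ↔ Sum.inl (wallCell hh j z) ∈ U := by
  suffices H : ∀ (n : ℕ) (hn : n < h + 1), (Sum.inl (wallCell hh j ⟨n, hn⟩) ∈ U ↔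
      Sum.inl (wallCell hh j 0) ∈ U) from (H y.val y.isLt).trans (H z.val z.isLt).symm
  have hh' := Nat.odd_iff.mp hh
  intro n
  induction n with
  | zero => exact fun _ => Iff.rfl
  | succ n ih =>
    intro hn
    rw [← ih (by omega)]
    have hne : ∀ {p q : WallVertex h}, p.1.2.val ≠ q.1.2.val → p ≠ q := fun h₁ h₂ => h₁ (h₂ ▸ rfl)
    have hne' : ∀ {p q : WallVertex h}, p.1.1.val ≠ q.1.1.val → p ≠ q := fun h₁ h₂ => h₁ (h₂ ▸ rfl)
    -- For even `n` the edge up from row `n` is in the column `2j + 1` of the cells. For odd `n` it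
    -- is in the column `2j`, and the path makes a detour through two points there; as `n` and `h`
    -- are odd, neither is a missing corner.
    by_cases heven : n % 2 = 0
    · refine hU.mem_iff_of_adj (wallCell_mem_wallStrip hh j _) (wallCell_mem_wallStrip hh j _) ?_
      refine ⟨hne (by simp), Or.inr (Or.inr ⟨rfl, rfl, ?_⟩)⟩
      rw [Nat.odd_iff]
      simp only [wallCell_x, wallCell_y]
      omega
    · have hcorner : ∀ m, m = n ∨ m = n + 1 → m < h + 1 ∧ m ≠ 0 ∧ m ≠ h := by
        intro m hm
        omega
      let p (m : ℕ) (hm : m = n ∨ m = n + 1) : WallVertex h :=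
        ⟨(⟨2 * j.val, by omega⟩, ⟨m, (hcorner m hm).1⟩), by
          exact ⟨fun hj => (hcorner m hm).2.1 hj.2, fun hj => (hcorner m hm).2.2 hj.2⟩⟩
      have hp : ∀ m hm, p m hm ∈ CliqueWidth.wallStrip h j := by
        intro m hm
        show (2 * j.val) / 2 = j.val
        omega
      have hrow : ∀ m hm, (wall h).Adj (p m hm) (wallCell hh j ⟨m, (hcorner m hm).1⟩) := by
        intro m hm
        exact ⟨hne' (by simp [p]), Or.inl (Or.inl ⟨rfl, rfl⟩)⟩
      have hcol : (wall h).Adj (p n (Or.inl rfl)) (p (n + 1) (Or.inr rfl)) := by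
        refine ⟨hne (by simp [p]), Or.inl (Or.inr ⟨rfl, rfl, ?_⟩)⟩
        rw [Nat.odd_iff]
        simp only [p]
        omega
      exact ((hU.mem_iff_of_adj (wallCell_mem_wallStrip hh j _) (hp _ (Or.inr rfl))
        (hrow _ (Or.inr rfl)).symm).trans
        (hU.mem_iff_of_adj (hp _ (Or.inr rfl)) (hp _ (Or.inl rfl)) hcol.symm)).trans
        (hU.mem_iff_of_adj (hp _ (Or.inl rfl)) (wallCell_mem_wallStrip hh j _) (hrow _ (Or.inl rfl)))

/-- With `t = 6c` bounding the cut rows and the cut strips, the height is chosen so that `N = h + 1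
= 4t + 4` and `h` is odd. The argument works for every vertex set `A`. -/
theorem lt_cliqueWidth_complementedWall (c : ℕ) (hhc : h = 24 * c + 3)
    (A : Set (SubdividedWallVertex h)) : c < cliqueWidth (complementedWall h A).graph := by
  classical
  have hh : Odd h := by
    rw [Nat.odd_iff]
    omega
  change c < cliqueWidth (complementOn (subdividedWall h) A)
  have : Nonempty (SubdividedWallVertex h) := ⟨Sum.inl (wallCell hh 0 0)⟩
  rw [lt_cliqueWidth_iff]
  intro k hk hcon
  let φ : Fin (h + 1) × Fin (h + 1) → SubdividedWallVertex h :=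
    fun p => Sum.inl (wallCell hh p.1 p.2)
  have hφ : Function.Injective φ := by
    intro p q hpq
    have hpq := Sum.inl_injective hpq
    have hx := congrArg (fun p : WallVertex h => p.1.1.val) hpq
    have hy := congrArg (fun p : WallVertex h => p.1.2.val) hpq
    simp only [wallCell_x, wallCell_y] at hx hy
    exact Prod.ext (Fin.ext (by omega)) (Fin.ext hy)
  have hT : (Set.range φ).ncard = (h + 1) * (h + 1) := by
    rw [← Set.image_univ, Set.ncard_image_of_injective _ hφ, Set.ncard_univ]
    simp
  have hN : h + 1 = 4 * (6 * c) + 4 := by omega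
  -- `s = tN + 1` is just too many cells for the first alternative of `card_filter_le_or_of_grid`.
  obtain ⟨U, f, h₁, h₂, hf⟩ := hcon.exists_balanced (s := 6 * c * (h + 1) + 1) (by omega)
    (Set.range φ) (by rw [hT]; nlinarith)
  have hcount : (U ∩ Set.range φ).ncard =
      ((Finset.univ : Finset (Fin (h + 1) × Fin (h + 1))).filter fun p =>
        Sum.inl (wallCell hh p.1 p.2) ∈ U).card := by
    rw [← Set.image_preimage_eq_inter_range, Set.ncard_image_of_injective _ hφ,
      ← Set.ncard_coe_finset]
    congr 1
    ext p
    simp [φ]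
  -- If `u` and `v` are both in `A` or both outside, complementation changes their adjacencies to
  -- `w` alike.
  have hg : ∀ u ∈ U, ∀ v ∈ U, (f u, decide (u ∈ A)) = (f v, decide (v ∈ A)) → ∀ w ∉ U,
      ((subdividedWall h).Adj u w ↔ (subdividedWall h).Adj v w) := by
    intro u hu v hv huv w hw
    obtain ⟨hfuv, hA⟩ := Prod.mk.inj huv
    have hA : u ∈ A ↔ v ∈ A := by simpa using hA
    have hadj : u ≠ w ∧ ((subdividedWall h).Adj u w ↔ ¬ (u ∈ A ∧ w ∈ A)) ↔
      v ≠ w ∧ ((subdividedWall h).Adj v w ↔ ¬ (v ∈ A ∧ w ∈ A)) := hf u hu v hv hfuv w hw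
    have huw : u ≠ w := fun h => hw (h ▸ hu)
    have hvw : v ≠ w := fun h => hw (h ▸ hv)
    tauto
  have hκ : Fintype.card (Fin k × Bool) = 2 * k := by
    simp [mul_comm]
  have hfinset : ∀ p : Fin (h + 1) → Prop, ∃ t : Finset (Fin (h + 1)), ∀ i, i ∈ t ↔ p i :=
    fun p => ⟨Finset.univ.filter p, by simp⟩
  obtain ⟨rows, hrows⟩ : ∃ rows : Finset (Fin (h + 1)), ∀ y, y ∈ rows ↔
      ¬ IsUncut (subdividedWall h) U (within (wall h) (wallRow h y)) :=
    hfinset _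
  obtain ⟨cols, hcols⟩ : ∃ cols : Finset (Fin (h + 1)), ∀ j, j ∈ cols ↔
      ¬ IsUncut (subdividedWall h) U (within (wall h) (wallStrip h j)) :=
    hfinset _
  have hrows_card := card_not_isUncut_le ncard_neighborSet_subdividedWall_le hg
    (R := fun y => within (wall h) (wallRow h y))
    (fun y z hyz => disjoint_within (Set.disjoint_left.mpr fun p hp hq =>
      hyz ((hp : p.1.2 = y).symm.trans hq))) rows fun y hy => (hrows y).mp hy
  have hcols_card := card_not_isUncut_le ncard_neighborSet_subdividedWall_le hg
    (R := fun j => within (wall h) (wallStrip h j))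
    (fun i j hij => disjoint_within (Set.disjoint_left.mpr fun p hp hq =>
      hij (Fin.ext ((hp : p.1.1.val / 2 = i.val).symm.trans hq)))) cols
    fun j hj => (hcols j).mp hj
  rw [hκ] at hrows_card hcols_card
  have key := card_filter_le_or_of_grid (t := 6 * c) (by omega)
    (fun j y : Fin (h + 1) => Sum.inl (wallCell hh j y) ∈ U) rows cols (by omega) (by omega)
    (fun y hy i j => IsUncut.wallRow hh (not_not.mp (mt (hrows y).mpr hy)) i j)
    (fun j hj y z => IsUncut.wallStrip hh (not_not.mp (mt (hcols j).mpr hj)) y z)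
  have htotal := Finset.card_filter_add_card_filter_not
    (s := (Finset.univ : Finset (Fin (h + 1) × Fin (h + 1))))
    (fun p => Sum.inl (wallCell hh p.1 p.2) ∈ U)
  rw [Finset.card_univ, Fintype.card_prod, Fintype.card_fin] at htotal
  rw [hcount] at h₁ h₂
  rcases key with key | key
  · omega
  -- Of the `4tN + 4N` cells fewer than `2tN + 2` are in `U`, so more than `tN` are outside.
  · have : (h + 1) * (h + 1) = 4 * (6 * c * (h + 1)) + 4 * (h + 1) := by
      conv_lhs => rw [show (h + 1) * (h + 1) = (4 * (6 * c) + 4) * (h + 1) by rw [hN]]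
      ring
    omega

end Wall

/-! ### Split graphs -/

section Split

variable {V : Type*} {G : SimpleGraph V}

theorem C4_isIndContained {a b c d : V} (hab : G.Adj a b) (hbc : G.Adj b c) (hcd : G.Adj c d)
    (hda : G.Adj d a) (hac : ¬ G.Adj a c) (hbd : ¬ G.Adj b d) (hac' : a ≠ c) (hbd' : b ≠ d) :
    C4.graph ⊴ G := by
  have hab' := hab.ne
  have hbc' := hbc.ne
  have hcd' := hcd.ne
  have hda' := hda.ne
  refine ⟨⟨⟨![a, b, c, d], ?_⟩, ?_⟩⟩
  · intro (i : Fin 4) (j : Fin 4) hij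
    fin_cases i <;> fin_cases j <;>
      first | rfl | simp_all [eq_comm]
  · intro (i : Fin 4) (j : Fin 4)
    change G.Adj (![a, b, c, d] i) (![a, b, c, d] j) ↔ (SimpleGraph.cycleGraph 4).Adj i j
    fin_cases i <;> fin_cases j <;>
      simp [SimpleGraph.cycleGraph_adj, hab, hab.symm, hbc, hbc.symm, hcd, hcd.symm, hda, hda.symm,
        hac, hbd, G.adj_comm c a, G.adj_comm d b] <;> decide

theorem twoP2_isIndContained {a b c d : V} (hab : G.Adj a b) (hcd : G.Adj c d)
    (hac : ¬ G.Adj a c) (had : ¬ G.Adj a d) (hbc : ¬ G.Adj b c) (hbd : ¬ G.Adj b d) :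
    twoP2.graph ⊴ G := by
  have hab' := hab.ne
  have hcd' := hcd.ne
  have hac' : a ≠ c := fun h => hbc (h ▸ hab.symm)
  have had' : a ≠ d := fun h => hbd (h ▸ hab.symm)
  have hbc' : b ≠ c := fun h => hac (h ▸ hab)
  have hbd' : b ≠ d := fun h => had (h ▸ hab)
  refine ⟨⟨⟨Sum.elim ![a, b] ![c, d], ?_⟩, ?_⟩⟩
  · intro (i : Fin 2 ⊕ Fin 2) (j : Fin 2 ⊕ Fin 2) hij
    rcases i with i | i <;> rcases j with j | j <;> fin_cases i <;> fin_cases j <;>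
      first | rfl | simp_all [eq_comm]
  · intro (i : Fin 2 ⊕ Fin 2) (j : Fin 2 ⊕ Fin 2)
    change G.Adj (Sum.elim ![a, b] ![c, d] i) (Sum.elim ![a, b] ![c, d] j) ↔
      (SimpleGraph.pathGraph 2 ⊕g SimpleGraph.pathGraph 2).Adj i j
    rcases i with i | i <;> rcases j with j | j <;> fin_cases i <;> fin_cases j <;>
      simp [SimpleGraph.pathGraph_adj, hab, hab.symm, hcd, hcd.symm, hac, had, hbc, hbd,
        G.adj_comm c a, G.adj_comm d a, G.adj_comm c b, G.adj_comm d b]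

theorem cycleGraph_five_isIndContained {a b c d e : V} (hab : G.Adj a b) (hbc : G.Adj b c)
    (hcd : G.Adj c d) (hde : G.Adj d e) (hea : G.Adj e a) (hac : ¬ G.Adj a c)
    (hbd : ¬ G.Adj b d) (hce : ¬ G.Adj c e) (hda : ¬ G.Adj d a) (heb : ¬ G.Adj e b) :
    SimpleGraph.cycleGraph 5 ⊴ G := by
  have hab' := hab.ne
  have hbc' := hbc.ne
  have hcd' := hcd.ne
  have hde' := hde.ne
  have hea' := hea.ne
  have hac' : a ≠ c := fun h => hda (h ▸ hcd.symm)
  have hbd' : b ≠ d := fun h => heb (h ▸ hde.symm)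
  have hce' : c ≠ e := fun h => hac (h ▸ hea.symm)
  have hda' : d ≠ a := fun h => hbd (h ▸ hab.symm)
  have heb' : e ≠ b := fun h => hce (h ▸ hbc.symm)
  refine ⟨⟨⟨![a, b, c, d, e], ?_⟩, ?_⟩⟩
  · intro i j hij
    fin_cases i <;> fin_cases j <;>
      first | rfl | simp_all [eq_comm]
  · intro i j
    change G.Adj (![a, b, c, d, e] i) (![a, b, c, d, e] j) ↔ (SimpleGraph.cycleGraph 5).Adj i j
    fin_cases i <;> fin_cases j <;>
      simp [SimpleGraph.cycleGraph_adj, hab, hab.symm, hbc, hbc.symm, hcd, hcd.symm, hde, hde.symm,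
        hea, hea.symm, hac, hbd, hce, hda, heb, G.adj_comm c a, G.adj_comm d b, G.adj_comm e c,
        G.adj_comm a d, G.adj_comm b e] <;> decide

/-- A finite graph without induced `C₄`, `2P₂` and `C₅` is split. -/
theorem isSplit_of_free [Finite V] (h₁ : ¬ C4.graph ⊴ G) (h₂ : ¬ twoP2.graph ⊴ G)
    (h₃ : ¬ SimpleGraph.cycleGraph 5 ⊴ G) : IsSplit G := by
  classical
  cases nonempty_fintype V
  obtain ⟨C₀, hC₀⟩ := G.exists_isNClique_cliqueNum
  obtain ⟨C, hC, hmax⟩ := (G.cliqueFinset G.cliqueNum).exists_max_image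
    (fun C => ∑ v ∈ C, G.degree v) ⟨C₀, SimpleGraph.mem_cliqueFinset_iff.mpr hC₀⟩
  rw [SimpleGraph.mem_cliqueFinset_iff] at hC
  have hbig : ∀ D : Finset V, G.IsClique D → D.card ≤ C.card := fun D hD =>
    hC.card_eq ▸ hD.card_le_cliqueNum
  have hnon : ∀ x ∉ C, ∃ u ∈ C, ¬ G.Adj x u := by
    intro x hx
    by_contra! hall
    have := hbig (insert x C) (by
      rw [Finset.coe_insert]
      exact hC.isClique.insert fun b hb _ => hall b hb)
    rw [Finset.card_insert_of_notMem hx] at this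
    omega
  refine ⟨C, hC.isClique, ?_⟩
  by_contra hI
  obtain ⟨x, hx, y, hy, hxy⟩ : ∃ x ∉ C, ∃ y ∉ C, G.Adj x y := by
    by_contra! hall
    exact hI fun x hx y hy _ => hall x hx y hy
  -- the sets of non-neighbours in `C` are comparable
  wlog hsub : ∀ u ∈ C, ¬ G.Adj x u → ¬ G.Adj y u generalizing x y
  · refine this y hy x hx hxy.symm ?_
    push Not at hsub
    obtain ⟨u, hu, hxu, hyu⟩ := hsub
    intro v hv hyv
    by_contra hxv
    have huv : u ≠ v := fun h => hyv (h ▸ hyu)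
    exact h₁ (C4_isIndContained hxy hyu (hC.isClique hu hv huv) hxv.symm hxu hyv
      (fun h => hx (h ▸ hu)) (fun h => hy (h ▸ hv)))
  obtain ⟨z, hz, hxz⟩ := hnon x hx
  have hyz := hsub z hz hxz
  have honly : ∀ u ∈ C, u ≠ z → G.Adj x u := by
    intro u hu huz
    by_contra hxu
    exact h₂ (twoP2_isIndContained hxy (hC.isClique hu hz huz) hxu hxz (hsub u hu hxu) hyz)
  -- exchange `z` for `x`
  have hx' : x ∉ C.erase z := fun h => hx (Finset.mem_of_mem_erase h)
  have hdeg : G.degree x ≤ G.degree z := by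
    have := hmax (insert x (C.erase z)) (by
      rw [SimpleGraph.mem_cliqueFinset_iff]
      refine ⟨?_, ?_⟩
      · rw [Finset.coe_insert]
        refine (hC.isClique.subset (Finset.erase_subset z C)).insert fun b hb _ => ?_
        have hb := Finset.mem_erase.mp (Finset.mem_coe.mp hb)
        exact honly b hb.2 hb.1
      · rw [Finset.card_insert_of_notMem hx', Finset.card_erase_add_one hz, hC.card_eq])
    rw [Finset.sum_insert hx', ← Finset.add_sum_erase C _ hz] at this
    omega
  -- Since `y` is a neighbour of `x` but not of `z`, `deg x ≤ deg z` forces `z` to have a private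
  -- neighbour too.
  obtain ⟨w, hzw, hxw⟩ : ∃ w, G.Adj z w ∧ ¬ G.Adj x w := by
    by_contra! hall
    have hss : G.neighborFinset z ⊂ G.neighborFinset x := by
      rw [Finset.ssubset_iff_of_subset fun w hw => by simpa using hall w (by simpa using hw)]
      exact ⟨y, by simpa using hxy, by simpa [G.adj_comm] using hyz⟩
    have := Finset.card_lt_card hss
    simp only [SimpleGraph.card_neighborFinset_eq_degree] at this
    omega
  have hw : w ∉ C := fun h => hxw (honly w h hzw.ne')
  have hyw : G.Adj y w := by
    by_contra hyw
    exact h₂ (twoP2_isIndContained hxy hzw hxz hxw hyz hyw)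
  obtain ⟨c, hc, hwc⟩ := hnon w hw
  have hcz : c ≠ z := fun h => hwc (h ▸ hzw.symm)
  have hzc := hC.isClique hz hc hcz.symm
  by_cases hyc : G.Adj y c
  -- Depending on whether `y` and `c` are adjacent, `y, w, z, c` is an induced `C₄` or `x, y, w, z,
  -- c` an induced `C₅`.
  · exact h₁ (C4_isIndContained hyw hzw.symm hzc hyc.symm hyz hwc (fun h => hy (h ▸ hz))
      (fun h => hw (h ▸ hc)))
  · exact h₃ (cycleGraph_five_isIndContained hxy hyw hzw.symm hzc (honly c hc hcz).symm hxw hyz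
      hwc (fun h => hxz h.symm) (fun h => hyc h.symm))

theorem IsSplit.of_isIndContained {W : Type*} {H : SimpleGraph W} (hG : IsSplit G) (h : H ⊴ G) :
    IsSplit H := by
  obtain ⟨C, hC, hI⟩ := hG
  obtain ⟨f⟩ := h
  refine ⟨f ⁻¹' C, fun u hu v hv huv => ?_, fun u hu v hv huv => ?_⟩
  · exact f.map_adj_iff.mp (hC hu hv (f.injective.ne huv))
  · exact fun hadj => hI hu hv (f.injective.ne huv) (f.map_adj_iff.mpr hadj)

theorem not_isSplit_C4 : ¬ IsSplit C4.graph := by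
  rintro ⟨C, hC, hI⟩
  change Set (Fin 4) at C
  have hadj : ∀ i j : Fin 4, C4.graph.Adj i j ↔ (i - j = 1 ∨ j - i = 1) := fun i j => Iff.rfl
  have hc : ∀ i j : Fin 4, i ≠ j → ¬ (i - j = 1 ∨ j - i = 1) → i ∈ C → j ∉ C :=
    fun i j hij hn hi hj => hn ((hadj i j).mp (hC hi hj hij))
  have hi : ∀ i j : Fin 4, (i - j = 1 ∨ j - i = 1) → i ∉ C → j ∈ C := by
    intro i j hij h₁
    by_contra h₂
    exact hI h₁ h₂ ((hadj i j).mpr hij).ne ((hadj i j).mpr hij)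
  have h₀₂ := hc 0 2 (by decide) (by decide)
  have h₁₃ := hc 1 3 (by decide) (by decide)
  have h₀₁ := hi 0 1 (by decide)
  have h₁₂ := hi 1 2 (by decide)
  have h₂₃ := hi 2 3 (by decide)
  have h₃₀ := hi 3 0 (by decide)
  tauto

theorem not_isSplit_twoP2 : ¬ IsSplit twoP2.graph := by
  rintro ⟨C, hC, hI⟩
  change Set (Fin 2 ⊕ Fin 2) at C
  have hadj : ∀ i j : Fin 2 ⊕ Fin 2, twoP2.graph.Adj i j ↔
    (SimpleGraph.pathGraph 2 ⊕g SimpleGraph.pathGraph 2).Adj i j := fun i j => Iff.rfl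
  have hc : ∀ i j : Fin 2, Sum.inl i ∈ C → Sum.inr j ∉ C := by
    intro i j h₁ h₂
    have := (hadj _ _).mp (hC h₁ h₂ Sum.inl_ne_inr)
    simp at this
  have hl : Sum.inl 0 ∉ C → Sum.inl 1 ∈ C := by
    intro h₁
    by_contra h₂
    exact hI h₁ h₂ (Sum.inl_injective.ne (by decide)) ((hadj _ _).mpr (by simp [SimpleGraph.pathGraph_adj]))
  have hr : Sum.inr 0 ∉ C → Sum.inr 1 ∈ C := by
    intro h₁
    by_contra h₂
    exact hI h₁ h₂ (Sum.inr_injective.ne (by decide)) ((hadj _ _).mpr (by simp [SimpleGraph.pathGraph_adj]))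
  have h₀₀ := hc 0 0
  have h₀₁ := hc 0 1
  have h₁₀ := hc 1 0
  have h₁₁ := hc 1 1
  tauto

theorem isSelfComplementary_cycleGraph_five :
    IsSelfComplementary (SimpleGraph.cycleGraph 5) := by
  -- Modulo 5, doubling exchanges the differences `±1` and `±2`.
  refine ⟨⟨⟨fun i => 2 * i, fun i => 3 * i, by decide, by decide⟩, ?_⟩⟩
  intro i j
  revert i j
  simp only [SimpleGraph.compl_adj, SimpleGraph.cycleGraph_adj]
  decide

theorem not_nonempty_cycleGraph_five_iso_bull :
    ¬ Nonempty (SimpleGraph.cycleGraph 5 ≃g bull) := by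
  rintro ⟨f⟩
  have hfree : ∀ i j k : Fin 5, (SimpleGraph.cycleGraph 5).Adj i j →
      (SimpleGraph.cycleGraph 5).Adj j k → ¬ (SimpleGraph.cycleGraph 5).Adj i k := by
    simp only [SimpleGraph.cycleGraph_adj]
    decide
  refine hfree (f.symm 0) (f.symm 1) (f.symm 2) ?_ ?_ ?_ <;> rw [f.symm.map_adj_iff] <;>
    simp [bull]

theorem isSplit_of_mem_freeClass {G : FinGraph}
    (hG : G ∈ freeClass ({C4, twoP2} ∪ selfComplementaryNotBull)) : IsSplit G.graph := by
  have := G.fin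
  refine isSplit_of_free (hG C4 (by simp)) (hG twoP2 (by simp)) ?_
  refine hG ⟨Fin 5, SimpleGraph.cycleGraph 5⟩ (Or.inr ⟨isSelfComplementary_cycleGraph_five, ?_,
    not_nonempty_cycleGraph_five_iso_bull⟩)
  simp

end Split

/-! ### Sparsity of subdivided graphs -/

/-- Here `d` counts subdivision vertices and `v` original vertices in each part; `a` and `b` count
edges between the two kinds, `p` edges between subdivision vertices. A linear number of edges cannot
reach `l² / 2` for large `l`; small cases are checked. -/
theorem le_two_of_sparse {l e p a b dK dI vK vI : ℕ} (hK : vK + dK = l) (hI : vI + dI = l)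
    (he : 2 * e = l * l) (hle : e ≤ a + b + p) (ha : a ≤ dK) (hb : b ≤ dI) (ha' : a ≤ 3 * vI)
    (hb' : b ≤ 3 * vK) (hp : p ≤ dK) (hp' : p ≤ dI) (hpab : p + a + b ≤ vI * vK + dK + dI) :
    l ≤ 2 := by
  -- Weight `5/8` on `a ≤ dK`, `b ≤ dI`, weight `3/8` on `a ≤ 3 * vI`, `b ≤ 3 * vK`, and the mean of
  -- the bounds on `p` give `e ≤ 9l/4`.
  have h₁ : 8 * e ≤ 18 * l := by omega
  have h₂ : l ≤ 4 := by
    by_contra! h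
    nlinarith
  have hdK : dK ≤ 4 := by omega
  have hdI : dI ≤ 4 := by omega
  by_contra! h₃
  interval_cases l
  -- For `l = 3` the number `l * l` is odd. For `l = 4` the bound `hpab` is essential: it excludes
  -- `dK = dI = 3` with `a = b = 3`, `p = 2`.
  · omega
  · interval_cases dK <;> interval_cases dI <;>
      (obtain rfl : vK = _ := Nat.eq_sub_of_add_eq hK) <;>
      (obtain rfl : vI = _ := Nat.eq_sub_of_add_eq hI) <;> omega

section TwoSubdivision

variable {V : Type*} [Finite V] {G : SimpleGraph V}

open Classical in
-- Each subdivision vertex has one original neighbour and one subdivision neighbour, so the edges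
-- between `K` and `I` fall into the three kinds `FK`, `FI`, `P`, to be counted for
-- `le_two_of_sparse`.
theorem card_le_two_of_two_mul_card_eq (hG : ∀ v, (G.neighborSet v).ncard ≤ 3)
    (K I : Finset (V ⊕ G.Dart)) (hKI : K.card = I.card)
    (he : 2 * ((K ×ˢ I).filter fun p => (twoSubdivision G).Adj p.1 p.2).card = K.card * K.card) :
    K.card ≤ 2 := by
  set FK := K.toRight.filter fun d => Sum.inl d.fst ∈ I with hFK
  set FI := I.toRight.filter fun d => Sum.inl d.fst ∈ K with hFI
  set P := K.toRight.filter fun d => Sum.inr d.symm ∈ I with hP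
  have hcover : ((K ×ˢ I).filter fun p => (twoSubdivision G).Adj p.1 p.2) ⊆
      (FK.image (fun d => (Sum.inr d, Sum.inl d.fst)) ∪
        FI.image (fun d => (Sum.inl d.fst, Sum.inr d))) ∪
        P.image (fun d => (Sum.inr d, Sum.inr d.symm)) := by
    rintro ⟨u | d, v | d'⟩ h <;> rw [Finset.mem_filter, Finset.mem_product] at h <;>
      obtain ⟨⟨hu, hv⟩, hadj⟩ := h
    · simp at hadj
    · rw [twoSubdivision_adj_inl_inr] at hadj
      subst hadj
      simp_all
    · rw [twoSubdivision_adj_inr_inl] at hadj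
      subst hadj
      simp_all
    · rw [twoSubdivision_adj_inr_inr] at hadj
      subst hadj
      simp_all
  have hle := (Finset.card_le_card hcover).trans ((Finset.card_union_le _ _).trans
    (add_le_add ((Finset.card_union_le _ _).trans
      (add_le_add Finset.card_image_le Finset.card_image_le)) Finset.card_image_le))
  have hfiber : ∀ (D : Finset G.Dart) (S : Finset V), (∀ d ∈ D, d.fst ∈ S) →
      D.card ≤ 3 * S.card := by
    intro D S hDS
    refine Finset.card_le_mul_card_image_of_maps_to (f := fun d => d.fst) hDS 3 fun v _ => ?_
    rw [← Set.ncard_coe_finset]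
    refine (Set.ncard_le_ncard ?_).trans ((ncard_dart_fst_le v).trans (hG v))
    intro d hd
    exact (Finset.mem_filter.mp hd).2
  have hsymm : Function.Injective (SimpleGraph.Dart.symm (G := G)) :=
    SimpleGraph.Dart.symm_involutive.injective
  have hpI : P.card ≤ I.toRight.card := by
    refine Finset.card_le_card_of_injOn SimpleGraph.Dart.symm ?_ hsymm.injOn
    intro d hd
    simpa using (Finset.mem_filter.mp hd).2
  -- Edges of `P` that extend to a full subdivided edge are determined by its two ends, as `G` is
  -- simple. Any other edge of `P` uses up a subdivision vertex outside `FK` or `FI`.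
  have hfull : (P.filter fun d => d ∈ FK ∧ d.symm ∈ FI).card ≤ I.toLeft.card * K.toLeft.card := by
    rw [← Finset.card_product]
    refine Finset.card_le_card_of_injOn (fun d => d.toProd) ?_
      SimpleGraph.Dart.toProd_injective.injOn
    intro d hd
    simp only [hFK, hFI, Finset.coe_filter, Finset.mem_filter, Set.mem_ofPred_eq] at hd
    simp only [Finset.coe_product, Set.mem_prod, Finset.mem_coe, Finset.mem_toLeft]
    exact ⟨hd.2.1.2, hd.2.2.2⟩
  have hP' : P ⊆ (P.filter fun d => d ∈ FK ∧ d.symm ∈ FI) ∪ (K.toRight \ FK) ∪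
      (I.toRight \ FI).image SimpleGraph.Dart.symm := by
    intro d hd
    have hdK : d ∈ K.toRight := (Finset.mem_filter.mp hd).1
    have hdI : d.symm ∈ I.toRight := by simpa using (Finset.mem_filter.mp hd).2
    rw [Finset.mem_union, Finset.mem_union, Finset.mem_filter, Finset.mem_sdiff, Finset.mem_image]
    by_cases h₁ : d ∈ FK
    · by_cases h₂ : d.symm ∈ FI
      · exact Or.inl (Or.inl ⟨hd, h₁, h₂⟩)
      · exact Or.inr ⟨d.symm, Finset.mem_sdiff.mpr ⟨hdI, h₂⟩, SimpleGraph.Dart.symm_symm d⟩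
    · exact Or.inl (Or.inr ⟨hdK, h₁⟩)
  have hPcard := (Finset.card_le_card hP').trans ((Finset.card_union_le _ _).trans
    (add_le_add (Finset.card_union_le _ _) Finset.card_image_le))
  have hFKsub : FK ⊆ K.toRight := Finset.filter_subset _ _
  have hFIsub : FI ⊆ I.toRight := Finset.filter_subset _ _
  rw [Finset.card_sdiff_of_subset hFKsub, Finset.card_sdiff_of_subset hFIsub] at hPcard
  have hFKle := Finset.card_le_card hFKsub
  have hFIle := Finset.card_le_card hFIsub
  exact le_two_of_sparse K.card_toLeft_add_card_toRight
    (I.card_toLeft_add_card_toRight.trans hKI.symm) he hle hFKle hFIle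
    (hfiber _ _ fun d hd => by simpa using (Finset.mem_filter.mp hd).2)
    (hfiber _ _ fun d hd => by simpa using (Finset.mem_filter.mp hd).2)
    (Finset.card_le_card (Finset.filter_subset _ _)) hpI (by omega)

end TwoSubdivision

/-! ### Self-complementary split graphs -/

section SelfComplementary

variable {V : Type*} {H : SimpleGraph V}

theorem IsSelfComplementary.exists_perm (h : IsSelfComplementary H) :
    ∃ φ : Equiv.Perm V, ∀ u v, u ≠ v → (H.Adj (φ u) (φ v) ↔ ¬ H.Adj u v) := by
  obtain ⟨φ⟩ := h
  refine ⟨φ.toEquiv, fun u v huv => ?_⟩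
  have := φ.map_adj_iff (v := u) (w := v)
  rw [SimpleGraph.compl_adj] at this
  have hne : φ u ≠ φ v := φ.injective.ne huv
  change H.Adj (φ u) (φ v) ↔ _
  tauto

theorem IsSelfComplementary.compl (h : IsSelfComplementary H) : IsSelfComplementary Hᶜ := by
  obtain ⟨φ, hφ⟩ := h.exists_perm
  refine ⟨⟨φ, ?_⟩⟩
  intro u v
  by_cases huv : u = v
  · simp [huv]
  · have := hφ u v huv
    simp only [SimpleGraph.compl_adj, ne_eq, EmbeddingLike.apply_eq_iff_eq, not_and, not_not]
    tauto

/-- A dominating vertex would be mapped to an isolated one, and a graph on at least two vertices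
cannot have both. -/
theorem IsSelfComplementary.exists_not_adj [Nontrivial V] (h : IsSelfComplementary H) (a : V) :
    ∃ u, u ≠ a ∧ ¬ H.Adj a u := by
  by_contra! hall
  obtain ⟨φ, hφ⟩ := h.exists_perm
  have hiso : ∀ u, ¬ H.Adj (φ a) u := by
    intro u hu
    obtain ⟨w, rfl⟩ := φ.surjective u
    have hw : w ≠ a := fun h => hu.ne (h ▸ rfl)
    exact (hφ a w hw.symm).mp hu (hall w hw)
  by_cases ha : φ a = a
  · obtain ⟨u, hu⟩ := exists_ne a
    exact hiso u (ha.symm ▸ hall u hu)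
  · exact hiso a (hall _ ha).symm

theorem IsSelfComplementary.exists_adj [Nontrivial V] (h : IsSelfComplementary H) (a : V) :
    ∃ u, H.Adj a u := by
  obtain ⟨u, hu, hau⟩ := h.compl.exists_not_adj a
  refine ⟨u, ?_⟩
  rw [SimpleGraph.compl_adj] at hau
  by_contra hn
  exact hau ⟨hu.symm, hn⟩

open Classical in
/-- A self-complementary split graph has, apart from at most one vertex, equally large parts `K`
and `I`, and half of the pairs in `K × I` are edges. -/
theorem IsSelfComplementary.exists_balanced_parts [Fintype V] (h : IsSelfComplementary H)
    (C : Finset V) (hC : H.IsClique (C : Set V)) (hI : H.IsIndepSet ((Cᶜ : Finset V) : Set V)) :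
    ∃ K I R : Finset V, K ⊆ C ∧ I ⊆ Cᶜ ∧ K.card = I.card ∧ R.card ≤ 1 ∧
      Disjoint K I ∧ Disjoint (K ∪ I) R ∧ K ∪ I ∪ R = Finset.univ ∧
      (∀ v ∈ R, ∀ u ∈ K, H.Adj v u) ∧ (∀ v ∈ R, ∀ u ∈ I, ¬ H.Adj v u) := by
  obtain ⟨φ, hφ⟩ := h.exists_perm
  have hD : ∀ u ∈ C.map φ.toEmbedding, ∀ v ∈ C.map φ.toEmbedding, ¬ H.Adj u v := by
    intro u hu v hv huv
    obtain ⟨x, hx, rfl⟩ := Finset.mem_map.mp hu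
    obtain ⟨y, hy, rfl⟩ := Finset.mem_map.mp hv
    have hxy : x ≠ y := fun h => huv.ne (h ▸ rfl)
    exact (hφ x y hxy).mp huv (hC hx hy hxy)
  have hE : ∀ u ∈ Cᶜ.map φ.toEmbedding, ∀ v ∈ Cᶜ.map φ.toEmbedding, u ≠ v → H.Adj u v := by
    intro u hu v hv huv
    obtain ⟨x, hx, rfl⟩ := Finset.mem_map.mp hu
    obtain ⟨y, hy, rfl⟩ := Finset.mem_map.mp hv
    have hxy : x ≠ y := fun h => huv (h ▸ rfl)
    exact (hφ x y hxy).mpr (hI (Finset.mem_coe.mpr hx) (Finset.mem_coe.mpr hy) hxy)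
  have hDcard : (C.map φ.toEmbedding).card = C.card := Finset.card_map _
  have hEcard : (Cᶜ.map φ.toEmbedding).card = Cᶜ.card := Finset.card_map _
  set D := C.map φ.toEmbedding
  set E := Cᶜ.map φ.toEmbedding
  -- A clique and an independent set share at most one vertex. Hence the sizes of `C` and `Cᶜ`
  -- differ by at most one.
  have hDC : (D ∩ C).card ≤ 1 := by
    rw [Finset.card_le_one]
    intro u hu v hv
    by_contra huv
    rw [Finset.mem_inter] at hu hv
    exact hD u hu.1 v hv.1 (hC hu.2 hv.2 huv)
  have hEC : (E ∩ Cᶜ).card ≤ 1 := by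
    rw [Finset.card_le_one]
    intro u hu v hv
    by_contra huv
    rw [Finset.mem_inter] at hu hv
    exact hI (Finset.mem_coe.mpr hu.2) (Finset.mem_coe.mpr hv.2) huv (hE u hu.1 v hv.1 huv)
  have hDsplit : (D ∩ C).card + (D ∩ Cᶜ).card = D.card := by
    rw [← Finset.sdiff_eq_inter_compl, Finset.card_inter_add_card_sdiff]
  have hEsplit : (E ∩ Cᶜ).card + (E ∩ C).card = E.card := by
    rw [add_comm, ← Finset.card_inter_add_card_sdiff E C, Finset.sdiff_eq_inter_compl]
  have hDle : (D ∩ Cᶜ).card ≤ Cᶜ.card := Finset.card_le_card Finset.inter_subset_right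
  have hEle : (E ∩ C).card ≤ C.card := Finset.card_le_card Finset.inter_subset_right
  have hcases : C.card = Cᶜ.card ∨ C.card = Cᶜ.card + 1 ∨ Cᶜ.card = C.card + 1 := by omega
  rcases hcases with hcase | hcase | hcase
  · exact ⟨C, Cᶜ, ∅, subset_rfl, subset_rfl, hcase, by simp, disjoint_compl_right, by simp,
      by simp, by simp, by simp⟩
  · obtain ⟨v, hv⟩ := Finset.card_pos.mp (show 0 < (D ∩ C).card by omega)
    rw [Finset.mem_inter] at hv
    -- The independent set `D` consists of `v` and all of `Cᶜ`, so `v` has no neighbour in `Cᶜ` and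
    -- can serve as the exceptional vertex.
    have hsub : D ∩ Cᶜ = Cᶜ := Finset.eq_of_subset_of_card_le Finset.inter_subset_right (by omega)
    refine ⟨C.erase v, Cᶜ, {v}, Finset.erase_subset _ _, subset_rfl, ?_, by simp, ?_, ?_, ?_, ?_,
      ?_⟩
    · rw [Finset.card_erase_of_mem hv.2]
      omega
    · exact disjoint_compl_right.mono_left (Finset.erase_subset _ _)
    · simp [hv.2]
    · ext u
      simp only [Finset.mem_union, Finset.mem_erase, Finset.mem_compl, Finset.mem_singleton,
        Finset.mem_univ, iff_true]
      tauto
    · intro w hw u hu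
      rw [Finset.mem_singleton] at hw
      subst hw
      rw [Finset.mem_erase] at hu
      exact hC hv.2 hu.2 hu.1.symm
    · intro w hw u hu
      rw [Finset.mem_singleton] at hw
      subst hw
      exact hD w hv.1 u (Finset.inter_subset_left (hsub.symm ▸ hu))
  · obtain ⟨v, hv⟩ := Finset.card_pos.mp (show 0 < (E ∩ Cᶜ).card by omega)
    rw [Finset.mem_inter] at hv
    have hsub : E ∩ C = C := Finset.eq_of_subset_of_card_le Finset.inter_subset_right (by omega)
    refine ⟨C, Cᶜ.erase v, {v}, subset_rfl, Finset.erase_subset _ _, ?_, by simp, ?_, ?_, ?_, ?_,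
      ?_⟩
    · rw [Finset.card_erase_of_mem hv.2]
      omega
    · exact disjoint_compl_right.mono_right (Finset.erase_subset _ _)
    · simpa using hv.2
    · ext u
      simp only [Finset.mem_union, Finset.mem_erase, Finset.mem_compl, Finset.mem_singleton,
        Finset.mem_univ, iff_true]
      tauto
    · intro w hw u hu
      rw [Finset.mem_singleton] at hw
      subst hw
      refine hE w hv.1 u (Finset.inter_subset_left (hsub.symm ▸ hu)) fun h => ?_
      exact Finset.mem_compl.mp hv.2 (h ▸ hu)
    · intro w hw u hu
      rw [Finset.mem_singleton] at hw
      subst hw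
      rw [Finset.mem_erase] at hu
      exact hI (Finset.mem_coe.mpr hv.2) (Finset.mem_coe.mpr hu.2) hu.1.symm

open Classical in
theorem IsSelfComplementary.two_mul_sum_adj [Fintype V] (h : IsSelfComplementary H) :
    2 * (∑ u, ∑ v, if H.Adj u v then 1 else 0) + Fintype.card V =
      Fintype.card V * Fintype.card V := by
  obtain ⟨φ, hφ⟩ := h.exists_perm
  have h₁ : (∑ u, ∑ v, if H.Adj u v then 1 else 0) =
      ∑ u, ∑ v, if u ≠ v ∧ ¬ H.Adj u v then 1 else 0 := by
    rw [← Equiv.sum_comp φ]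
    refine Finset.sum_congr rfl fun u _ => ?_
    rw [← Equiv.sum_comp φ]
    refine Finset.sum_congr rfl fun v _ => ?_
    by_cases huv : u = v
    · simp [huv]
    · simp [huv, hφ u v huv]
  have h₂ : (∑ u : V, ∑ v : V, if u = v then 1 else 0) = Fintype.card V := by simp
  rw [two_mul]
  nth_rewrite 2 [h₁]
  nth_rewrite 1 [← h₂]
  rw [← Finset.sum_add_distrib, ← Finset.sum_add_distrib]
  have h₃ : ∀ u v : V, ((if H.Adj u v then 1 else 0) + (if u ≠ v ∧ ¬ H.Adj u v then 1 else 0)) +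
      (if u = v then 1 else 0) = 1 := by
    intro u v
    by_cases huv : u = v
    · simp [huv]
    · by_cases hadj : H.Adj u v <;> simp [huv, hadj]
  simp only [← Finset.sum_add_distrib, h₃]
  simp

open Classical in
-- Half of all pairs are edges. The complete pairs inside `K` and between `R` and `K` balance the
-- empty ones inside `I` and between `R` and `I`, so half of `K × I` must be edges.
theorem IsSelfComplementary.two_mul_card_eq [Fintype V] (h : IsSelfComplementary H)
    {K I R : Finset V} (hK : H.IsClique (K : Set V)) (hI : H.IsIndepSet (I : Set V))
    (hcard : K.card = I.card) (hR : R.card ≤ 1) (hKI : Disjoint K I) (hKIR : Disjoint (K ∪ I) R)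
    (huniv : K ∪ I ∪ R = Finset.univ) (hRK : ∀ v ∈ R, ∀ u ∈ K, H.Adj v u)
    (hRI : ∀ v ∈ R, ∀ u ∈ I, ¬ H.Adj v u) :
    2 * ((K ×ˢ I).filter fun p => H.Adj p.1 p.2).card = K.card * K.card := by
  have htotal := h.two_mul_sum_adj
  have hsum : ∀ f : V → ℕ, ∑ u, f u = ∑ u ∈ K, f u + ∑ u ∈ I, f u + ∑ u ∈ R, f u := by
    intro f
    rw [← huniv, Finset.sum_union hKIR, Finset.sum_union hKI]
  have hn : Fintype.card V = K.card + I.card + R.card := by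
    rw [← Finset.card_univ, ← huniv, Finset.card_union_of_disjoint hKIR,
      Finset.card_union_of_disjoint hKI]
  let e (X Y : Finset V) : ℕ := ∑ u ∈ X, ∑ v ∈ Y, if H.Adj u v then 1 else 0
  have hcomm : ∀ X Y, e X Y = e Y X := by
    intro X Y
    simp only [e]
    rw [Finset.sum_comm]
    simp only [H.adj_comm]
  have hempty : ∀ X Y : Finset V, (∀ u ∈ X, ∀ v ∈ Y, ¬ H.Adj u v) → e X Y = 0 := by
    intro X Y hXY
    exact Finset.sum_eq_zero fun u hu => Finset.sum_eq_zero fun v hv => if_neg (hXY u hu v hv)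
  have hfull : ∀ X Y : Finset V, (∀ u ∈ X, ∀ v ∈ Y, H.Adj u v) → e X Y = X.card * Y.card := by
    intro X Y hXY
    have : ∀ u ∈ X, (∑ v ∈ Y, if H.Adj u v then 1 else 0) = Y.card := by
      intro u hu
      rw [Finset.card_eq_sum_ones]
      exact Finset.sum_congr rfl fun v hv => if_pos (hXY u hu v hv)
    simp only [e]
    rw [Finset.sum_congr rfl this, Finset.sum_const, smul_eq_mul]
  have hKK : e K K + K.card = K.card * K.card := by
    have : ∀ u ∈ K, (∑ v ∈ K, if H.Adj u v then 1 else 0) + 1 = K.card := by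
      intro u hu
      rw [← Finset.add_sum_erase K _ hu, if_neg H.irrefl, zero_add,
        ← Finset.card_erase_add_one hu, Finset.card_eq_sum_ones (K.erase u)]
      congr 1
      refine Finset.sum_congr rfl fun v hv => if_pos ?_
      rw [Finset.mem_erase] at hv
      exact hK hu hv.2 hv.1.symm
    calc e K K + K.card = ∑ u ∈ K, ((∑ v ∈ K, if H.Adj u v then 1 else 0) + 1) := by
          rw [Finset.sum_add_distrib, ← Finset.card_eq_sum_ones]
      _ = K.card * K.card := by
          rw [Finset.sum_congr rfl this, Finset.sum_const, smul_eq_mul]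
  have hII : e I I = 0 := hempty I I fun u hu v hv huv => hI hu hv huv.ne huv
  have hRR : e R R = 0 := hempty R R fun u hu v hv huv =>
    huv.ne (Finset.card_le_one.mp hR u hu v hv)
  have hRKe := hfull R K hRK
  have hRIe := hempty R I hRI
  have hKIe : ((K ×ˢ I).filter fun p => H.Adj p.1 p.2).card = e K I := by
    rw [Finset.card_filter, Finset.sum_product]
  have hexpand : (∑ u, ∑ v, if H.Adj u v then 1 else 0) =
      (e K K + e K I + e K R) + (e I K + e I I + e I R) + (e R K + e R I + e R R) := by
    rw [hsum]
    simp only [hsum, Finset.sum_add_distrib, e]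
  rw [hexpand, hn, hcomm I K, hcomm K R, hcomm I R, hII, hRR, hRKe, hRIe, ← hcard] at htotal
  rw [hKIe]
  have hR' : R.card * R.card = R.card := by
    interval_cases R.card <;> rfl
  nlinarith

theorem nonempty_iso_bull {a b c d e : V} (hcard : Nat.card V = 5) (hab : H.Adj a b)
    (hbc : H.Adj b c) (hac : H.Adj a c) (had : H.Adj a d) (hbe : H.Adj b e)
    (hae : ¬ H.Adj a e) (hbd : ¬ H.Adj b d) (hcd : ¬ H.Adj c d) (hce : ¬ H.Adj c e)
    (hde : ¬ H.Adj d e) : Nonempty (H ≃g bull) := by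
  have hab' := hab.ne
  have hbc' := hbc.ne
  have hac' := hac.ne
  have had' := had.ne
  have hbe' := hbe.ne
  have hae' : a ≠ e := fun h => hce (h ▸ hac.symm)
  have hbd' : b ≠ d := fun h => hcd (h ▸ hbc.symm)
  have hcd' : c ≠ d := fun h => hbd (h ▸ hbc)
  have hce' : c ≠ e := fun h => hae (h ▸ hac)
  have hde' : d ≠ e := fun h => hae (h ▸ had)
  have hinj : Function.Injective ![a, b, c, d, e] := by
    intro i j hij
    fin_cases i <;> fin_cases j <;> first | rfl | simp_all [eq_comm]
  have : Finite V := Nat.finite_of_card_ne_zero (by omega)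
  cases nonempty_fintype V
  have hbij : Function.Bijective ![a, b, c, d, e] := by
    rw [Fintype.bijective_iff_injective_and_card]
    exact ⟨hinj, by rw [Fintype.card_fin, ← Nat.card_eq_fintype_card, hcard]⟩
  refine ⟨SimpleGraph.Iso.symm ⟨Equiv.ofBijective _ hbij, ?_⟩⟩
  intro i j
  change H.Adj (![a, b, c, d, e] i) (![a, b, c, d, e] j) ↔ bull.Adj i j
  fin_cases i <;> fin_cases j <;>
    simp [bull, hab, hab.symm, hbc, hbc.symm, hac, hac.symm, had, had.symm, hbe, hbe.symm, hae,
      hbd, hcd, hce, hde, H.adj_comm e a, H.adj_comm d b, H.adj_comm d c, H.adj_comm e c,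
      H.adj_comm e d]

open Classical in
/-- The bull is the only self-complementary split graph on five vertices. -/
theorem IsSelfComplementary.iso_bull [Fintype V] (h : IsSelfComplementary H)
    {K I R : Finset V} (hK : H.IsClique (K : Set V)) (hI : H.IsIndepSet (I : Set V))
    (hKcard : K.card = 2) (hIcard : I.card = 2) (hR : R.card = 1) (hKI : Disjoint K I)
    (hKIR : Disjoint (K ∪ I) R) (huniv : K ∪ I ∪ R = Finset.univ)
    (hRK : ∀ v ∈ R, ∀ u ∈ K, H.Adj v u) (hRI : ∀ v ∈ R, ∀ u ∈ I, ¬ H.Adj v u)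
    (he : 2 * ((K ×ˢ I).filter fun p => H.Adj p.1 p.2).card = K.card * K.card) :
    Nonempty (H ≃g bull) := by
  have hn : Nat.card V = 5 := by
    rw [Nat.card_eq_fintype_card, ← Finset.card_univ, ← huniv,
      Finset.card_union_of_disjoint hKIR, Finset.card_union_of_disjoint hKI, hKcard, hIcard, hR]
  obtain ⟨a, b, hab, rfl⟩ := Finset.card_eq_two.mp hKcard
  obtain ⟨c, d, hcd, rfl⟩ := Finset.card_eq_two.mp hIcard
  obtain ⟨v, rfl⟩ := Finset.card_eq_one.mp hR
  have : Nontrivial V := ⟨a, b, hab⟩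
  have hvert : ∀ u, u = a ∨ u = b ∨ u = c ∨ u = d ∨ u = v := by
    intro u
    have := huniv.symm ▸ Finset.mem_univ u
    simp only [Finset.mem_union, Finset.mem_insert, Finset.mem_singleton] at this
    tauto
  have hab₁ : H.Adj a b := hK (by simp) (by simp) hab
  have hcd₁ : ¬ H.Adj c d := hI (by simp) (by simp) hcd
  have hva : H.Adj v a := hRK v (by simp) a (by simp)
  have hvb : H.Adj v b := hRK v (by simp) b (by simp)
  have hvc : ¬ H.Adj v c := hRI v (by simp) c (by simp)
  have hvd : ¬ H.Adj v d := hRI v (by simp) d (by simp)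
  have he' : (if H.Adj a c then 1 else 0) + (if H.Adj a d then 1 else 0) +
      ((if H.Adj b c then 1 else 0) + (if H.Adj b d then 1 else 0)) = 2 := by
    rw [hKcard, Finset.card_filter, Finset.sum_product, Finset.sum_pair hab, Finset.sum_pair hcd,
      Finset.sum_pair hcd] at he
    dsimp only at he
    omega
  obtain ⟨ua, hua, hna⟩ := h.exists_not_adj a
  obtain ⟨ub, hub, hnb⟩ := h.exists_not_adj b
  obtain ⟨uc, huc⟩ := h.exists_adj c
  obtain ⟨ud, hud⟩ := h.exists_adj d
  have hA : ¬ (H.Adj a c ∧ H.Adj a d) := by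
    rintro ⟨h₁, h₂⟩
    rcases hvert ua with rfl | rfl | rfl | rfl | rfl
    exacts [hua rfl, hna hab₁, hna h₁, hna h₂, hna hva.symm]
  have hB : ¬ (H.Adj b c ∧ H.Adj b d) := by
    rintro ⟨h₁, h₂⟩
    rcases hvert ub with rfl | rfl | rfl | rfl | rfl
    exacts [hnb hab₁.symm, hub rfl, hnb h₁, hnb h₂, hnb hvb.symm]
  have hC : H.Adj a c ∨ H.Adj b c := by
    rcases hvert uc with rfl | rfl | rfl | rfl | rfl
    exacts [Or.inl huc.symm, Or.inr huc.symm, absurd huc H.irrefl, absurd huc hcd₁,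
      absurd huc.symm hvc]
  have hD : H.Adj a d ∨ H.Adj b d := by
    rcases hvert ud with rfl | rfl | rfl | rfl | rfl
    exacts [Or.inl hud.symm, Or.inr hud.symm, absurd hud.symm hcd₁, absurd hud H.irrefl,
      absurd hud.symm hvd]
  -- The edges between `{a, b}` and `{c, d}` form a perfect matching; the two possible matchings
  -- differ by exchanging `c` and `d`.
  by_cases hac : H.Adj a c
  · have had : ¬ H.Adj a d := fun h => hA ⟨hac, h⟩
    have hbd := hD.resolve_left had
    exact nonempty_iso_bull hn hab₁ hvb.symm hva.symm hac hbd had (fun h => hB ⟨h, hbd⟩) hvc hvd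
      hcd₁
  · have hbc := hC.resolve_left hac
    have hbd : ¬ H.Adj b d := fun h => hB ⟨hbc, h⟩
    have had := hD.resolve_right hbd
    exact nonempty_iso_bull hn hab₁ hvb.symm hva.symm had hbc hac hbd hvd hvc
      fun h => hcd₁ h.symm

end SelfComplementary

/-! ### Complementing one side of a bipartition -/

section ComplementOn

variable {V : Type*} {G : SimpleGraph V} {A : Set V}

theorem complementOn_adj {u v : V} :
    (complementOn G A).Adj u v ↔ u ≠ v ∧ (G.Adj u v ↔ ¬ (u ∈ A ∧ v ∈ A)) :=
  Iff.rfl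

theorem not_adj_of_isBipartiteWith_compl (hA : G.IsBipartiteWith A Aᶜ) {u v : V}
    (huv : u ∈ A ↔ v ∈ A) : ¬ G.Adj u v := by
  intro h
  have := hA.mem_of_adj h
  simp only [Set.mem_compl_iff] at this
  tauto

theorem complementOn_adj_iff_of_mem_of_notMem {u v : V} (hu : u ∈ A) (hv : v ∉ A) :
    (complementOn G A).Adj u v ↔ G.Adj u v := by
  have : u ≠ v := fun h => hv (h ▸ hu)
  rw [complementOn_adj]
  tauto

theorem isClique_complementOn (hA : G.IsBipartiteWith A Aᶜ) : (complementOn G A).IsClique A := by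
  intro u hu v hv huv
  have := not_adj_of_isBipartiteWith_compl hA (iff_of_true hu hv)
  rw [complementOn_adj]
  tauto

theorem isIndepSet_complementOn (hA : G.IsBipartiteWith A Aᶜ) :
    (complementOn G A).IsIndepSet Aᶜ := by
  intro u hu v hv huv
  have := not_adj_of_isBipartiteWith_compl hA (iff_of_false hu hv)
  rw [Set.mem_compl_iff] at hu
  rw [complementOn_adj]
  tauto

end ComplementOn

/-- A self-complementary graph on at least five vertices that is an induced subgraph of the graph
obtained from a 2-subdivision of a graph of maximum degree three by complementing one side of a
bipartition is the bull. -/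
theorem IsSelfComplementary.iso_bull_of_isIndContained {V W : Type*} [Finite V] [Finite W]
    {G : SimpleGraph V} (hG : ∀ v, (G.neighborSet v).ncard ≤ 3) {A : Set (V ⊕ G.Dart)}
    (hA : (twoSubdivision G).IsBipartiteWith A Aᶜ) {H : SimpleGraph W}
    (hH : IsSelfComplementary H) (hcard : 5 ≤ Nat.card W)
    (hHG : H ⊴ complementOn (twoSubdivision G) A) : Nonempty (H ≃g bull) := by
  classical
  cases nonempty_fintype W
  obtain ⟨f⟩ := hHG
  have hclique : H.IsClique ((Finset.univ.filter fun v => f v ∈ A : Finset W) : Set W) := by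
    intro u hu v hv huv
    exact f.map_adj_iff.mp (isClique_complementOn hA (by simpa using hu) (by simpa using hv)
      (f.injective.ne huv))
  have hindep : H.IsIndepSet (((Finset.univ.filter fun v => f v ∈ A)ᶜ : Finset W) : Set W) := by
    intro u hu v hv huv hadj
    exact isIndepSet_complementOn hA (by simpa using hu) (by simpa using hv)
      (f.injective.ne huv) (f.map_adj_iff.mpr hadj)
  obtain ⟨K, I, R, hKC, hIC, hKI, hR, hdisj, hdisj', huniv, hRK, hRI⟩ :=
    hH.exists_balanced_parts _ hclique hindep
  have hK := hclique.subset (Finset.coe_subset.mpr hKC)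
  have hI : H.IsIndepSet (I : Set W) := hindep.mono (Finset.coe_subset.mpr hIC)
  have he := hH.two_mul_card_eq hK hI hKI hR hdisj hdisj' huniv hRK hRI
  have hKA : ∀ u ∈ K, f u ∈ A := fun u hu => by simpa using hKC hu
  have hIA : ∀ u ∈ I, f u ∉ A := fun u hu => by simpa using hIC hu
  have hmap : ((K.map f.toEmbedding ×ˢ I.map f.toEmbedding).filter
      fun p => (twoSubdivision G).Adj p.1 p.2).card =
      ((K ×ˢ I).filter fun p => H.Adj p.1 p.2).card := by
    rw [Finset.card_filter, Finset.card_filter, Finset.sum_product, Finset.sum_product,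
      Finset.sum_map]
    refine Finset.sum_congr rfl fun u hu => ?_
    rw [Finset.sum_map]
    refine Finset.sum_congr rfl fun v hv => ?_
    refine if_congr ?_ rfl rfl
    exact (complementOn_adj_iff_of_mem_of_notMem (hKA u hu) (hIA v hv)).symm.trans f.map_adj_iff
  have hle := card_le_two_of_two_mul_card_eq hG (K.map f.toEmbedding) (I.map f.toEmbedding)
    (by simpa using hKI) (by rw [hmap, he, Finset.card_map])
  rw [Finset.card_map] at hle
  have hn : Nat.card W = K.card + I.card + R.card := by
    rw [Nat.card_eq_fintype_card, ← Finset.card_univ, ← huniv,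
      Finset.card_union_of_disjoint hdisj', Finset.card_union_of_disjoint hdisj]
  -- At least five vertices, parts of equal size at most two and at most one further vertex: all
  -- these bounds are attained.
  exact hH.iso_bull hK hI (by omega) (by omega) (by omega) hdisj hdisj' huniv hRK hRI he

theorem complementedWall_mem_freeClass {h : ℕ} {A : Set (SubdividedWallVertex h)}
    (hA : (subdividedWall h).IsBipartiteWith A Aᶜ) :
    complementedWall h A ∈ freeClass ({C4, twoP2} ∪ selfComplementaryNotBull) := by
  have hsplit : IsSplit (complementedWall h A).graph :=
    ⟨A, isClique_complementOn hA, isIndepSet_complementOn hA⟩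
  rintro H ((rfl | rfl) | ⟨hsc, hcard, hbull⟩) hH
  · exact not_isSplit_C4 (hsplit.of_isIndContained hH)
  · exact not_isSplit_twoP2 (hsplit.of_isIndContained hH)
  · have := H.fin
    exact hbull (hsc.iso_bull_of_isIndContained ncard_neighborSet_wall_le hA hcard hH)

end CliqueWidth

theorem mainTheorem8 :
    -- the class has unbounded clique-width
    ¬ BoundedCliqueWidth (freeClass ({C4, twoP2} ∪ selfComplementaryNotBull)) ∧
    -- all graphs in the class are split graphs
    (∀ G ∈ freeClass ({C4, twoP2} ∪ selfComplementaryNotBull), IsSplit G.graph) ∧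
    -- every 2-subdivided wall is bipartite
    (∀ h : ℕ, 1 ≤ h → ∃ A : Set (SubdividedWallVertex h),
      (subdividedWall h).IsBipartiteWith A Aᶜ) ∧
    -- complementing one side of its bipartition gives a graph in the class
    (∀ h : ℕ, 1 ≤ h → ∀ A : Set (SubdividedWallVertex h),
      (subdividedWall h).IsBipartiteWith A Aᶜ →
        complementedWall h A ∈ freeClass ({C4, twoP2} ∪ selfComplementaryNotBull)) ∧
    -- and the graphs so obtained have unbounded clique-width
    (∀ c : ℕ, ∃ h : ℕ, 1 ≤ h ∧ ∀ A : Set (SubdividedWallVertex h),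
      (subdividedWall h).IsBipartiteWith A Aᶜ →
        c < cliqueWidth (complementedWall h A).graph) := by
  refine ⟨?_, fun G hG => isSplit_of_mem_freeClass hG,
    fun h _ => exists_isBipartiteWith_subdividedWall h,
    fun h _ A hA => complementedWall_mem_freeClass hA,
    fun c => ⟨24 * c + 3, by omega, fun A _ => lt_cliqueWidth_complementedWall c rfl A⟩⟩
  rintro ⟨c, hc⟩
  obtain ⟨A, hA⟩ := exists_isBipartiteWith_subdividedWall (24 * c + 3)
  exact absurd (hc _ (complementedWall_mem_freeClass hA))
    (not_le.mpr (lt_cliqueWidth_complementedWall c rfl A))
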